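/- **Definitions.** For a partition $\lambda$ of $n$ let $\chi_\lambda$ be the irreducible character of the symmetric group $S_n$ indexed by $\lambda$ (the character of the Specht module $S^\lambda$; $\chi_{(n)}$ is trivial and $\chi_{(1^n)}$ is the sign). For an $n\times n$ matrix $M=(m_{ij})$ with $n\ge 1$ and an integer $k$, let $$d_k(M)=\sum_{\sigma\in S_n}\chi_{(k,1^{n-k})}(\sigma)\prod_{i=1}^n m_{i\sigma(i)}\quad\text{if }1\le k\le n,\qquad d_k(M)=0\quad\text{if }k<1\text{ or }k>n .$$ For the $0\times 0$ matrix $\varnothing$ put $d_k(\varnothing)=(-1)^{k-1}$ if $k\ge 1$ and $d_k(\varnothing)=0$ if $k\le 0$. The hook immanantal polynomial of $M$ is $\Phi_k(M)=\Phi_k(M,x)=d_k(xI_n-M)$. Let $G$ be a finite simple graph with degree matrix $D(G)$ and adjacency matrix $A(G)$, let $\beta,\gamma\in\mathbb R$, and let $H(G)=\beta D(G)+\gamma A(G)$. For $S\subseteq V(G)$ let $H_S(G)$ be the principal submatrix of $H(G)$ obtained by deleting the rows and columns indexed by $S$; write $H_v(G)$ for $S=\{v\}$ and $H_{uv}(G)$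 for $S=\{u,v\}$. Let $d(v)$ and $N(v)$ be the degree and the neighbourhood of $v$ in $G$, let $\mathfrak C_G(v)$ and $\mathfrak C_G(e)$ be the sets of cycles (of length at least $3$, as subgraphs of $G$) that contain the vertex $v$ and the edge $e$, respectively, let $V(C)$ be the vertex set of $C$, and let $G-e$ be $G$ with the edge $e$ deleted (all vertices kept). **Theorem 1.1.** Let $k$ be an integer. The following are identities of polynomials in $x$. (i) For every vertex $v$ of $G$, $$\begin{aligned}\Phi_k(H(G),x)={}&(x-\beta d(v))\bigl[\Phi_{k-1}(H_v(G))+\Phi_k(H_v(G))\bigr]+\gamma^2\sum_{u\in N(v)}\bigl[\Phi_{k-2}(H_{uv}(G))-\Phi_k(H_{uv}(G))\bigr]\\&+2\sum_{C\in\mathfrak C_G(v)}\gamma^{|V(C)|}\bigl[(-1)^{|V(C)|}\Phi_{k-|V(C)|}(H_{V(C)}(G))-\Phi_k(H_{V(C)}(G))\bigr].\end{aligned}$$ (ii) For every edge $e=uv$ of $G$, $$\begin{aligned}\Phi_k(H(G),x)={}&\Phi_k(H(G-e),x)-\beta\bigl[\Phi_k(H_v(G-e))+\Phi_{k-1}(H_v(G-e))\bigr]-\beta\bigl[\Phi_k(H_u(G-e))+\Phi_{k-1}(H_u(G-e))\bigr]\\&+\bigl[(\beta^2-\gamma^2)\Phi_k(H_{uv}(G))+2\beta^2\Phi_{k-1}(H_{uv}(G))+(\beta^2+\gamma^2)\Phi_{k-2}(H_{uv}(G))\bigr]\\&+2\sum_{C\in\mathfrak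 C_G(e)}\gamma^{|V(C)|}\bigl[(-1)^{|V(C)|}\Phi_{k-|V(C)|}(H_{V(C)}(G))-\Phi_k(H_{V(C)}(G))\bigr].\end{aligned}$$ -/

import Mathlib

open Polynomial

noncomputable section

/-! ### Irreducible characters of symmetric groups: Specht modules

A Young tableau of shape `μ` with entries in a finite set `α` is a bijection `t : α ≃ μ.cells`
(the entry `a` sits in the cell `t a = (row, column)`).  A tabloid (a tableau up to permuting the
entries of each row) is recorded by the function `α → ℕ` that sends an entry to its row.  The group
`Equiv.Perm α` permutes tabloids, and the Specht module is the span of all polytabloids.  It is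
taken over `ℚ`; this is an absolutely irreducible representation, so its trace is the (integer
valued) complex irreducible character indexed by `μ`. -/

/-- The permutation representation of `Equiv.Perm α` on formal `ℚ`-linear combinations of row
assignments `r : α → ℕ`; it contains the permutation module on tabloids of each shape. -/
def rowAssignmentRep (α : Type*) : Representation ℚ (Equiv.Perm α) ((α → ℕ) →₀ ℚ) where
  toFun g := Finsupp.lmapDomain ℚ ℚ (fun r : α → ℕ => fun a => r (g⁻¹ a))
  map_one' := Finsupp.lmapDomain_id ℚ ℚ
  map_mul' g h := by
    rw [Module.End.mul_eq_comp, ← Finsupp.lmapDomain_comp]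
    congr 1

theorem rowAssignmentRep_single {α : Type*} (g : Equiv.Perm α) (r : α → ℕ) (c : ℚ) :
    rowAssignmentRep α g (Finsupp.single r c) = Finsupp.single (fun a => r (g⁻¹ a)) c := by
  change Finsupp.mapDomain _ _ = _
  rw [Finsupp.mapDomain_single]

/-- The row of each entry of the tableau `t`, that is, the tabloid of `t`. -/
def tabloid {α : Type*} {μ : YoungDiagram} (t : α ≃ {c : ℕ × ℕ // c ∈ μ.cells}) : α → ℕ :=
  fun a => (t a).1.1

/-- The permutation `q` preserves every column of the tableau `t`. -/
def PreservesColumns {α : Type*} {μ : YoungDiagram} (t : α ≃ {c : ℕ × ℕ // c ∈ μ.cells})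
    (q : Equiv.Perm α) : Prop :=
  ∀ a, (t (q a)).1.2 = (t a).1.2

open Classical in
/-- The polytabloid `e_t = ∑ sgn(q) q{t}`, summed over the column group of `t`. -/
def polytabloid {α : Type*} [Fintype α] {μ : YoungDiagram}
    (t : α ≃ {c : ℕ × ℕ // c ∈ μ.cells}) : (α → ℕ) →₀ ℚ :=
  ∑ q : Equiv.Perm α with PreservesColumns t q,
    ((Equiv.Perm.sign q : ℤ) : ℚ) • rowAssignmentRep α q (Finsupp.single (tabloid t) 1)

theorem rowAssignmentRep_polytabloid {α : Type*} [Fintype α] {μ : YoungDiagram}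
    (g : Equiv.Perm α) (t : α ≃ {c : ℕ × ℕ // c ∈ μ.cells}) :
    rowAssignmentRep α g (polytabloid t) = polytabloid (g⁻¹.trans t) := by
  classical
  unfold polytabloid
  rw [map_sum]
  refine Finset.sum_equiv (MulAut.conj g).toEquiv ?_ ?_
  · intro q
    rw [Finset.mem_filter_univ, Finset.mem_filter_univ]
    constructor
    · intro hq a
      simpa using hq (g⁻¹ a)
    · intro hq a
      simpa using hq (g a)
  · intro q _
    have h : (Finsupp.single (tabloid (g⁻¹.trans t)) 1 : (α → ℕ) →₀ ℚ)
        = rowAssignmentRep α g (Finsupp.single (tabloid t) 1) :=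
      (rowAssignmentRep_single g (tabloid t) 1).symm
    rw [h, map_smul, ← Module.End.mul_apply, ← Module.End.mul_apply, ← map_mul, ← map_mul]
    have hs : Equiv.Perm.sign ((MulAut.conj g).toEquiv q) = Equiv.Perm.sign q := by
      simp [mul_right_comm]
    have hm : (MulAut.conj g).toEquiv q * g = g * q := by
      simp
    rw [hs, hm]

/-- The Specht module of shape `μ`: the span of all polytabloids of shape `μ`.
(It is zero if `μ` does not have exactly `|α|` cells.) -/
def spechtModule (α : Type*) [Fintype α] (μ : YoungDiagram) :
    Subrepresentation (rowAssignmentRep α) where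
  toSubmodule := Submodule.span ℚ
    (Set.range fun t : α ≃ {c : ℕ × ℕ // c ∈ μ.cells} => polytabloid t)
  apply_mem_toSubmodule g v hv := by
    induction hv using Submodule.span_induction with
    | mem x hx =>
      obtain ⟨t, rfl⟩ := hx
      exact Submodule.subset_span ⟨g⁻¹.trans t, (rowAssignmentRep_polytabloid g t).symm⟩
    | zero => simp
    | add x y _ _ hx hy => rw [map_add]; exact Submodule.add_mem _ hx hy
    | smul c x _ hx => rw [map_smul]; exact Submodule.smul_mem _ c hx

/-- The irreducible character `χ_μ` of the symmetric group on `α`: the trace on the Specht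
module. -/
def irreducibleCharacter {α : Type*} [Fintype α] (μ : YoungDiagram) (σ : Equiv.Perm α) : ℚ :=
  LinearMap.trace ℚ (spechtModule α μ).toSubmodule ((spechtModule α μ).toRepresentation σ)

/-! ### Hook immanants -/

/-- The immanant `d_μ(M) = ∑_σ χ_μ(σ) ∏_i M i (σ i)`. -/
def immanant {α : Type*} [Fintype α] [DecidableEq α] {A : Type*} [CommRing A] [Algebra ℚ A]
    (μ : YoungDiagram) (M : Matrix α α A) : A :=
  ∑ σ : Equiv.Perm α, irreducibleCharacter μ σ • ∏ i, M i (σ i)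

/-- The hook `(k, 1^m)` with `k ≥ 1`: one row of length `k` followed by `m` rows of length one. -/
def hookDiagram (k m : ℕ) (hk : 1 ≤ k) : YoungDiagram :=
  YoungDiagram.ofRowLens (k :: List.replicate m 1) (by
    apply List.Pairwise.sortedGE
    simp only [List.pairwise_cons, List.mem_replicate, List.pairwise_replicate]
    exact ⟨fun a ha => ha.2 ▸ hk, Or.inr le_rfl⟩)

/-- The hook immanant `d_k(M)` of an `n × n` matrix, for every integer `k`.  If `n ≥ 1`, it is the
immanant of the hook `(k, 1^(n-k))` for `1 ≤ k ≤ n`, and `0` otherwise.  For the `0 × 0` matrix,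
which has no hook shape, the convention is `(-1)^(k-1)` if `k ≥ 1`, and `0` otherwise. -/
def hookImmanant {α : Type*} [Fintype α] [DecidableEq α] {A : Type*} [CommRing A] [Algebra ℚ A]
    (k : ℤ) (M : Matrix α α A) : A :=
  if Fintype.card α = 0 then
    if 1 ≤ k then (-1) ^ (k - 1).toNat else 0
  else if h : 1 ≤ k ∧ k ≤ Fintype.card α then
    immanant (hookDiagram k.toNat (Fintype.card α - k.toNat) (by omega)) M
  else 0

/-- The hook immanantal polynomial `Φ_k(M, x) = d_k(x I - M)`; `Matrix.charmatrix M` is the matrix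
`x I - M` with entries in `ℝ[X]`. -/
def hookImmanantPoly {α : Type*} [Fintype α] [DecidableEq α] (k : ℤ) (M : Matrix α α ℝ) : ℝ[X] :=
  hookImmanant k M.charmatrix

/-! ### Graph matrices and cycles -/

/-- The matrix `H(G) = β D(G) + γ A(G)`. -/
def graphMatrix {V : Type*} [Fintype V] [DecidableEq V] (β γ : ℝ) (G : SimpleGraph V)
    [DecidableRel G.Adj] : Matrix V V ℝ :=
  β • G.degMatrix ℝ + γ • G.adjMatrix ℝ

/-- The principal submatrix `M_S` obtained by deleting the rows and columns indexed by `S`. -/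
def deleteRowsCols {V : Type*} (M : Matrix V V ℝ) (S : Finset V) :
    Matrix {w : V // w ∉ S} {w : V // w ∉ S} ℝ :=
  M.submatrix Subtype.val Subtype.val

/-- A subgraph `C` of `G` is a cycle (of length at least three) of `G`. -/
def IsCycleSubgraph {V : Type*} {G : SimpleGraph V} (C : G.Subgraph) : Prop :=
  ∃ (u : V) (p : G.Walk u u), p.IsCycle ∧ p.toSubgraph = C

open Classical in
/-- The set of cycles of `G` that contain the vertex `v`. -/
def cyclesThroughVertex {V : Type*} [Fintype V] (G : SimpleGraph V) (v : V) : Finset G.Subgraph :=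
  {C | IsCycleSubgraph C ∧ v ∈ C.verts}

open Classical in
/-- The set of cycles of `G` that contain the edge `e`. -/
def cyclesThroughEdge {V : Type*} [Fintype V] (G : SimpleGraph V) (e : Sym2 V) :
    Finset G.Subgraph :=
  {C | IsCycleSubgraph C ∧ e ∈ C.edgeSet}

open Classical in
/-- The vertex set `V(C)` of a subgraph, as a finset. -/
def vertexFinset {V : Type*} [Fintype V] {G : SimpleGraph V} (C : G.Subgraph) : Finset V :=
  {w | w ∈ C.verts}

end

open Polynomial

noncomputable section

/-! ### Polytabloids of hook shape -/

/-! All hook immanants of a matrix are packed into one polynomial that is multiplicative over the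
cycles of permutations. The Specht module of `(k, 1^m)` behaves as the `m`-th exterior power of the
sum-zero subspace of the permutation module. Hence for fixed `σ` in `S_n`, `n ≥ 1`, the hook
characters are the coefficients of `X * det (X + P_σ) / (1 + X)`; dividing by `1 + X` removes the
trivial summand (`irreducibleCharacter_hookDiagram`, `X_add_one_mul_charpoly`). So `d_k(M)` is the
coefficient of `X ^ k` in `X * f / (1 + X)`, where `f = ∑ σ, det (X + P_σ) ∏ M i (σ i)`
(`hookImmanant_eq_hookCoeff`). The convention for the empty matrix is exactly what makes this hold
with `f = 1`.

An `l`-cycle contributes the factor `X ^ l - (-1) ^ l` to `det (X + P_σ)`. Sorting permutations by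
their cycle through `v` therefore expands `f` into polynomials of principal submatrices
(`immanantPoly_eq_sum_cycles`). For a graph matrix only three kinds of cycle survive: the fixed
point, a transposition along an edge at `v`, and the two orientations of each graph cycle through
`v`. That is (i) after taking coefficients, since multiplication by `X` turns `k` into `k - 1`.

For (ii), the edge is removed in three moves: the two diagonal entries are changed one at a time
(`immanantPoly_update_diagonal`), then the off-diagonal pair is set to zero
(`immanantPoly_delete_edge`), which kills exactly the cycles that use the edge. -/

theorem mem_hookDiagram {k m : ℕ} {hk : 1 ≤ k} {c : ℕ × ℕ} :
    c ∈ (hookDiagram k m hk).cells ↔ (c.1 ≤ m ∧ c.2 = 0) ∨ (c.1 = 0 ∧ 1 ≤ c.2 ∧ c.2 < k) := by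
  rw [YoungDiagram.mem_cells, hookDiagram, YoungDiagram.mem_ofRowLens]
  obtain ⟨i, j⟩ := c
  rcases i with _ | i
  · simp
    omega
  · simp [Nat.succ_le_iff]

theorem card_hookDiagram {k m : ℕ} (hk : 1 ≤ k) : (hookDiagram k m hk).cells.card = k + m := by
  have h : (hookDiagram k m hk).cells =
      (Finset.range (m + 1) ×ˢ {0}) ∪ ({0} ×ˢ Finset.Ico 1 k) := by
    ext c
    rw [mem_hookDiagram]
    simp only [Finset.mem_union, Finset.mem_product, Finset.mem_range, Finset.mem_singleton,
      Finset.mem_Ico]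
    omega
  rw [h, Finset.card_union_of_disjoint]
  · simp
    omega
  · rw [Finset.disjoint_left]
    intro c
    simp only [Finset.mem_product, Finset.mem_range, Finset.mem_singleton, Finset.mem_Ico]
    omega

/-- The entries of the first column of a tableau of hook shape, from top to bottom. -/
def firstColumn {α : Type*} {k m : ℕ} {hk : 1 ≤ k}
    (t : α ≃ {c : ℕ × ℕ // c ∈ (hookDiagram k m hk).cells}) (i : Fin (m + 1)) : α :=
  t.symm ⟨(i, 0), mem_hookDiagram.2 (Or.inl ⟨Nat.lt_succ_iff.1 i.2, rfl⟩)⟩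

theorem firstColumn_injective {α : Type*} {k m : ℕ} {hk : 1 ≤ k}
    (t : α ≃ {c : ℕ × ℕ // c ∈ (hookDiagram k m hk).cells}) :
    Function.Injective (firstColumn t) := by
  intro i j h
  have := t.symm.injective h
  simpa [Fin.ext_iff] using this

theorem exists_tableau_firstColumn {α : Type*} [Fintype α] {k m : ℕ} (hk : 1 ≤ k)
    (hα : Fintype.card α = k + m) (f : Fin (m + 1) → α) (hf : Function.Injective f) :
    ∃ t : α ≃ {c : ℕ × ℕ // c ∈ (hookDiagram k m hk).cells}, firstColumn t = f := by
  have e : α ≃ {c : ℕ × ℕ // c ∈ (hookDiagram k m hk).cells} := by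
    refine Fintype.equivOfCardEq ?_
    rw [hα, ← card_hookDiagram hk, Fintype.card_coe]
  obtain ⟨g, hg⟩ := Equiv.Perm.exists_extending_pair f (firstColumn e) hf (firstColumn_injective e)
  refine ⟨g.trans e, funext fun i => ?_⟩
  change g.symm (firstColumn e i) = f i
  rw [← hg, Equiv.symm_apply_apply]

open Classical in
/-- The row assignment that puts `c i` in row `i + 1` and all other entries in row `0`. -/
def rowsOf {α : Type*} {m : ℕ} (c : Fin m → α) (a : α) : ℕ :=
  ∑ i : Fin m, if c i = a then (i : ℕ) + 1 else 0

theorem rowsOf_apply_of_injective {α : Type*} {m : ℕ} {c : Fin m → α}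
    (hc : Function.Injective c) (i : Fin m) : rowsOf c (c i) = i + 1 := by
  classical
  rw [rowsOf, Finset.sum_eq_single i]
  · simp
  · intro j _ hj
    rw [if_neg (hc.ne hj)]
  · simp

theorem rowsOf_apply_of_notMem {α : Type*} {m : ℕ} {c : Fin m → α} {a : α}
    (ha : ∀ i, c i ≠ a) : rowsOf c a = 0 := by
  classical
  exact Finset.sum_eq_zero fun i _ => if_neg (ha i)

theorem rowsOf_injOn {α : Type*} {m : ℕ} {c c' : Fin m → α} (hc : Function.Injective c)
    (hc' : Function.Injective c') (h : rowsOf c = rowsOf c') : c = c' := by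
  funext i
  have h1 := congrFun h (c i)
  rw [rowsOf_apply_of_injective hc] at h1
  by_cases hi : ∃ j, c' j = c i
  · obtain ⟨j, hj⟩ := hi
    rw [← hj, rowsOf_apply_of_injective hc'] at h1
    have : i = j := Fin.ext (by omega)
    rw [← hj, this]
  · push Not at hi
    rw [rowsOf_apply_of_notMem hi] at h1
    omega

theorem rowAssignmentRep_single_rowsOf {α : Type*} {m : ℕ} (g : Equiv.Perm α) (c : Fin m → α) :
    rowAssignmentRep α g (Finsupp.single (rowsOf c) 1) = Finsupp.single (rowsOf (g ∘ c)) 1 := by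
  rw [rowAssignmentRep_single]
  congr 1
  funext a
  simp only [rowsOf, Function.comp_apply]
  refine Finset.sum_congr rfl fun i _ => ?_
  rw [Equiv.Perm.eq_inv_iff_eq]

theorem tabloid_eq_rowsOf {α : Type*} {k m : ℕ} {hk : 1 ≤ k}
    (t : α ≃ {c : ℕ × ℕ // c ∈ (hookDiagram k m hk).cells}) :
    tabloid t = rowsOf (firstColumn t ∘ Fin.succ) := by
  have hinj : Function.Injective (firstColumn t ∘ Fin.succ) :=
    (firstColumn_injective t).comp (Fin.succ_injective m)
  funext a
  by_cases ha : ∃ i : Fin m, firstColumn t i.succ = a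
  · obtain ⟨i, rfl⟩ := ha
    rw [show firstColumn t i.succ = (firstColumn t ∘ Fin.succ) i from rfl,
      rowsOf_apply_of_injective hinj]
    simp [tabloid, firstColumn]
  · push Not at ha
    rw [rowsOf_apply_of_notMem (c := firstColumn t ∘ Fin.succ) ha]
    by_contra h
    have hmem := mem_hookDiagram.1 (t a).2
    unfold tabloid at h
    refine ha ⟨(t a).1.1 - 1, by omega⟩ ?_
    rw [firstColumn, Equiv.symm_apply_eq]
    ext
    · simp
      omega
    · simp
      omega

/-- Every column of a hook other than the first is a single cell, so the column group is the full
symmetric group on the first column. -/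
theorem preservesColumns_iff {α : Type*} {k m : ℕ} {hk : 1 ≤ k}
    (t : α ≃ {c : ℕ × ℕ // c ∈ (hookDiagram k m hk).cells}) (q : Equiv.Perm α) :
    PreservesColumns t q ↔ ∀ a, a ∉ Set.range (firstColumn t) → q a = a := by
  have hcol : ∀ a, a ∈ Set.range (firstColumn t) ↔ (t a).1.2 = 0 := by
    intro a
    constructor
    · rintro ⟨i, rfl⟩
      simp [firstColumn]
    · intro h
      have hmem := mem_hookDiagram.1 (t a).2
      refine ⟨⟨(t a).1.1, by omega⟩, ?_⟩
      rw [firstColumn, Equiv.symm_apply_eq]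
      ext
      · simp
      · simp [h]
  simp only [hcol]
  constructor
  · intro h a ha
    apply t.injective
    have h1 := mem_hookDiagram.1 (t a).2
    have h2 := mem_hookDiagram.1 (t (q a)).2
    have h3 := h a
    ext <;> omega
  · intro h a
    by_cases ha : (t a).1.2 = 0
    · rw [ha]
      by_contra hq
      have := h _ hq
      exact hq (by rw [q.injective this, ha])
    · rw [h a ha]

/-- The matrix whose columns are the vectors `e_{f (j+1)} - e_{f 0}`. -/
def differenceMatrix {α : Type*} [DecidableEq α] {m : ℕ} (f : Fin (m + 1) → α) :
    Matrix α (Fin m) ℚ :=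
  Matrix.of fun x j => (if f j.succ = x then 1 else 0) - (if f 0 = x then 1 else 0)

/-- The left side is the determinant of the incidence matrix of `f` and `c` with a column of ones
prepended. That column records that the corner entry is unconstrained. Subtracting row `0` from the
other rows clears it below the corner, and expanding along it leaves the difference matrix. -/
theorem sum_perm_sign_eq_det {α : Type*} [DecidableEq α] {m : ℕ} (f : Fin (m + 1) → α)
    (c : Fin m → α) :
    ∑ π : Equiv.Perm (Fin (m + 1)), ((Equiv.Perm.sign π : ℤ) : ℚ) *
        (if f ∘ π ∘ Fin.succ = c then 1 else 0)
      = ((differenceMatrix f).submatrix c id).det := by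
  let A : Matrix (Fin (m + 1)) (Fin (m + 1)) ℚ :=
    Matrix.of fun j i => Fin.cases 1 (fun i' => if f j = c i' then 1 else 0) i
  let B : Matrix (Fin (m + 1)) (Fin (m + 1)) ℚ :=
    Matrix.of fun j i => if j = 0 then A 0 i else A j i - A 0 i
  have hA : A.det = ∑ π : Equiv.Perm (Fin (m + 1)), ((Equiv.Perm.sign π : ℤ) : ℚ) *
        (if f ∘ π ∘ Fin.succ = c then 1 else 0) := by
    rw [Matrix.det_apply']
    refine Finset.sum_congr rfl fun π _ => ?_
    rw [Fin.prod_univ_succ]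
    simp only [A, Matrix.of_apply, Fin.cases_zero, Fin.cases_succ, one_mul]
    rw [Finset.prod_ite_zero]
    simp [funext_iff]
  have hAB : A.det = B.det := by
    refine Matrix.det_eq_of_forall_row_eq_smul_add_const (fun i => if i = 0 then 0 else 1) 0
      (by simp) ?_
    intro i j
    by_cases hi : i = 0 <;> simp [B, hi]
  rw [← hA, hAB, Matrix.det_succ_column_zero, Finset.sum_eq_single 0]
  · rw [← Matrix.det_transpose ((differenceMatrix f).submatrix c id)]
    simp only [Fin.val_zero, pow_zero, one_mul, B, A, Matrix.of_apply, if_true, Fin.cases_zero]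
    congr 1
  · intro i _ hi
    simp [B, A, hi]
  · simp

/-- The formal sum of row assignments with antisymmetrized coefficients attached to a sequence. -/
def hookVector {α : Type*} [Fintype α] [DecidableEq α] {m : ℕ} (f : Fin (m + 1) → α) :
    (α → ℕ) →₀ ℚ :=
  ∑ c : Fin m → α, ((differenceMatrix f).submatrix c id).det • Finsupp.single (rowsOf c) 1

theorem hookVector_eq_sum_perm {α : Type*} [Fintype α] [DecidableEq α] {m : ℕ}
    (f : Fin (m + 1) → α) :
    hookVector f = ∑ π : Equiv.Perm (Fin (m + 1)), ((Equiv.Perm.sign π : ℤ) : ℚ) •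
      Finsupp.single (rowsOf (f ∘ π ∘ Fin.succ)) 1 := by
  simp only [hookVector, ← sum_perm_sign_eq_det, Finset.sum_smul]
  rw [Finset.sum_comm]
  refine Finset.sum_congr rfl fun π _ => ?_
  rw [Finset.sum_eq_single (f ∘ π ∘ Fin.succ)]
  · simp
  · intro c _ hc
    simp [hc.symm]
  · simp

/-- The column group is the group of permutations of positions in the first column, transported to
entries, and a hook tabloid is determined by the entries below the corner. The value of the detour
is that `hookVector` has determinantal coefficients and makes sense for arbitrary sequences. -/
theorem polytabloid_eq_hookVector {α : Type*} [Fintype α] [DecidableEq α] {k m : ℕ} {hk : 1 ≤ k}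
    (t : α ≃ {c : ℕ × ℕ // c ∈ (hookDiagram k m hk).cells}) :
    polytabloid t = hookVector (firstColumn t) := by
  obtain rfl : ‹DecidableEq α› = fun a b => Classical.propDecidable (a = b) :=
    Subsingleton.elim _ _
  classical
  rw [hookVector_eq_sum_perm, polytabloid]
  symm
  have hinj := firstColumn_injective t
  refine Finset.sum_bij (fun π _ => π.viaFintypeEmbedding ⟨firstColumn t, hinj⟩) ?_ ?_ ?_ ?_
  · intro π _
    rw [Finset.mem_filter_univ, preservesColumns_iff]
    intro a ha
    exact Equiv.Perm.viaFintypeEmbedding_apply_notMem_range _ _ ha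
  · intro π _ π' _ h
    ext i
    have := congrArg (fun q : Equiv.Perm α => q (firstColumn t i)) h
    have h1 := Equiv.Perm.viaFintypeEmbedding_apply_image π ⟨firstColumn t, hinj⟩ i
    have h2 := Equiv.Perm.viaFintypeEmbedding_apply_image π' ⟨firstColumn t, hinj⟩ i
    simp only [Function.Embedding.coeFn_mk] at h1 h2
    simp only [h1, h2] at this
    rw [hinj this]
  · intro q hq
    rw [Finset.mem_filter_univ, preservesColumns_iff] at hq
    have hq' : ∀ a, a ∈ Set.range (firstColumn t) → q a ∈ Set.range (firstColumn t) := by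
      intro a ha
      by_contra hn
      have := q.injective (hq _ hn)
      rw [this] at hn
      exact hn ha
    -- A column-preserving `q` restricts to the set of first-column entries; conjugating by `s`
    -- turns it into a permutation of positions.
    let s := Equiv.ofInjective _ hinj
    let q0 : Equiv.Perm (Set.range (firstColumn t)) := q.subtypePerm
      (fun a => ⟨fun ha => by
        by_contra hn
        rw [hq a hn] at ha
        exact hn ha, hq' a⟩)
    refine ⟨(s.trans q0).trans s.symm, Finset.mem_univ _, ?_⟩
    ext a
    by_cases ha : a ∈ Set.range (firstColumn t)
    · obtain ⟨i, rfl⟩ := ha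
      have h1 := Equiv.Perm.viaFintypeEmbedding_apply_image ((s.trans q0).trans s.symm)
        ⟨firstColumn t, hinj⟩ i
      simp only [Function.Embedding.coeFn_mk] at h1
      rw [h1]
      change firstColumn t (s.symm (q0 (s i))) = _
      have h2 : ∀ y, firstColumn t (s.symm y) = y := fun y => by
        exact congrArg Subtype.val (s.apply_symm_apply y)
      rw [h2]
      rfl
    · rw [Equiv.Perm.viaFintypeEmbedding_apply_notMem_range _ _ ha, hq a ha]
  · intro π _
    rw [Equiv.Perm.viaFintypeEmbedding_sign, tabloid_eq_rowsOf, rowAssignmentRep_single_rowsOf]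
    congr 3
    funext i
    exact (Equiv.Perm.viaFintypeEmbedding_apply_image π ⟨firstColumn t, hinj⟩ i.succ).symm

theorem rowAssignmentRep_hookVector {α : Type*} [Fintype α] [DecidableEq α] {m : ℕ}
    (g : Equiv.Perm α) (f : Fin (m + 1) → α) :
    rowAssignmentRep α g (hookVector f) = hookVector (g ∘ f) := by
  simp only [hookVector_eq_sum_perm, map_sum, map_smul, rowAssignmentRep_single_rowsOf]
  rfl

theorem det_submatrix_eq_zero_of_not_injective {α n R : Type*} [Fintype n] [DecidableEq n]
    [CommRing R] {β : Type*} (A : Matrix α β R) {c : n → α} (d : n → β)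
    (hc : ¬ Function.Injective c) : (A.submatrix c d).det = 0 := by
  rw [Function.not_injective_iff] at hc
  obtain ⟨i, j, hij, hne⟩ := hc
  exact Matrix.det_zero_of_row_eq hne (by ext x; simp [hij])

/-- A repetition of `f 0` gives the difference matrix a zero column; any other repetition gives it
two equal columns. -/
theorem hookVector_eq_zero_of_not_injective {α : Type*} [Fintype α] [DecidableEq α] {m : ℕ}
    {f : Fin (m + 1) → α} (hf : ¬ Function.Injective f) : hookVector f = 0 := by
  refine Finset.sum_eq_zero fun c _ => ?_
  suffices h : ((differenceMatrix f).submatrix c id).det = 0 by rw [h, zero_smul]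
  rw [Function.not_injective_iff] at hf
  obtain ⟨i, j, hij, hne⟩ := hf
  wlog hj : j ≠ 0 generalizing i j
  · push Not at hj
    exact this j i hij.symm hne.symm (hj ▸ hne)
  obtain ⟨j, rfl⟩ := Fin.exists_succ_eq.2 hj
  rcases Fin.eq_zero_or_eq_succ i with rfl | ⟨i, rfl⟩
  · exact Matrix.det_eq_zero_of_column_eq_zero j fun x => by simp [differenceMatrix, hij]
  · exact Matrix.det_zero_of_column_eq (i := i) (j := j) (fun h => hne (by rw [h]))
      fun x => by simp [differenceMatrix, hij]

/-! ### Determinantal identities -/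

theorem det_mul_eq_sum_prod_mul_det {n α R : Type*} [Fintype n] [DecidableEq n] [Fintype α]
    [DecidableEq α] [CommRing R] (A : Matrix n α R) (B : Matrix α n R) :
    (A * B).det = ∑ b : n → α, (∏ i, A i (b i)) * (B.submatrix b id).det := by
  have h : (A * B).det =
      (Matrix.detRowAlternating : (n → R) [⋀^n]→ₗ[R] R).toMultilinearMap
        (fun i => ∑ x : α, A i x • B x) := by
    change _ = Matrix.det (fun i => ∑ x : α, A i x • B x)
    congr 1
    ext i j
    simp [Matrix.mul_apply]
  rw [h, MultilinearMap.map_sum]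
  refine Finset.sum_congr rfl fun b _ => ?_
  rw [MultilinearMap.map_smul_univ]
  rfl

/-- The Cauchy-Binet formula, summed over all sequences rather than over subsets. -/
theorem sum_det_submatrix_mul_det_submatrix {n α R : Type*} [Fintype n] [DecidableEq n]
    [Fintype α] [DecidableEq α] [CommRing R] (A : Matrix n α R) (B : Matrix α n R) :
    ∑ b : n → α, (A.submatrix id b).det * (B.submatrix b id).det
      = ((Fintype.card n).factorial : R) * (A * B).det := by
  -- Each Leibniz term of `det A` contributes the same amount: reindexing `b` by `π` takes a sign
  -- out of the minor of `B`, and the two signs cancel.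
  have h : ∀ π : Equiv.Perm n, ∑ b : n → α, (((Equiv.Perm.sign π : ℤ) : R) *
      ∏ i, A (π i) (b i)) * (B.submatrix b id).det = (A * B).det := by
    intro π
    rw [det_mul_eq_sum_prod_mul_det]
    refine (Fintype.sum_equiv (Equiv.arrowCongr π (Equiv.refl α)).symm _ _ fun b => ?_).symm
    have h1 : (B.submatrix ((Equiv.arrowCongr π (Equiv.refl α)).symm b) id).det
        = ((Equiv.Perm.sign π : ℤ) : R) * (B.submatrix b id).det :=
      Matrix.det_permute π (B.submatrix b id)
    have h2 : ∏ i, A (π i) ((Equiv.arrowCongr π (Equiv.refl α)).symm b i) = ∏ i, A i (b i) :=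
      Equiv.prod_comp π fun i => A i (b i)
    have h3 : ((Equiv.Perm.sign π : ℤ) : R) * ((Equiv.Perm.sign π : ℤ) : R) = 1 := by
      rw [← Int.cast_mul, ← Units.val_mul, Int.units_mul_self]
      simp
    rw [h1, h2]
    linear_combination (-(∏ i, A i (b i)) * (B.submatrix b id).det) * h3
  calc _ = ∑ b : n → α, ∑ π : Equiv.Perm n, (((Equiv.Perm.sign π : ℤ) : R) *
        ∏ i, A (π i) (b i)) * (B.submatrix b id).det := by
        refine Finset.sum_congr rfl fun b _ => ?_
        rw [Matrix.det_apply', Finset.sum_mul]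
        rfl
    _ = _ := by
        rw [Finset.sum_comm, Finset.sum_congr rfl fun π _ => h π]
        simp [Fintype.card_perm]

/-- Sequences with a repetition give zero, and each `m`-subset is enumerated by `m!` injective
sequences, all with the same principal minor. -/
theorem sum_det_submatrix_eq_sum_minors {α R : Type*} [Fintype α] [DecidableEq α] [CommRing R]
    (N : Matrix α α R) (m : ℕ) :
    ∑ b : Fin m → α, (N.submatrix b b).det = (m.factorial : R) *
      ∑ s ∈ Finset.univ.powersetCard m,
        (N.submatrix (Subtype.val : s → α) (Subtype.val : s → α)).det := by
  classical
  have h1 : ∑ b : Fin m → α, (N.submatrix b b).det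
      = ∑ b : Fin m → α with Function.Injective b, (N.submatrix b b).det := by
    rw [Finset.sum_filter]
    refine Finset.sum_congr rfl fun b _ => ?_
    split_ifs with hb
    · rfl
    · exact det_submatrix_eq_zero_of_not_injective N b hb
  rw [h1, Finset.mul_sum, ← Finset.sum_fiberwise_of_maps_to
    (g := fun b : Fin m → α => Finset.univ.image b) (t := Finset.univ.powersetCard m)]
  · refine Finset.sum_congr rfl fun s hs => ?_
    have hs' : Fintype.card s = m := by
      rw [Fintype.card_coe]
      exact (Finset.mem_powersetCard.1 hs).2
    calc _ = ∑ e : Fin m ≃ s,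
          (N.submatrix (Subtype.val : s → α) (Subtype.val : s → α)).det := by
          symm
          refine Finset.sum_bij (fun e _ => fun i => (e i : α)) ?_ ?_ ?_ ?_
          · intro e _
            simp only [Finset.mem_filter, Finset.mem_univ, true_and]
            refine ⟨Subtype.val_injective.comp e.injective, ?_⟩
            ext x
            simp only [Finset.mem_image, Finset.mem_univ, true_and]
            constructor
            · rintro ⟨i, rfl⟩
              exact (e i).2
            · intro hx
              exact ⟨e.symm ⟨x, hx⟩, by simp⟩
          · intro e _ e' _ h
            ext i
            exact congrFun h i
          · intro b hb
            simp only [Finset.mem_filter, Finset.mem_univ, true_and] at hb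
            obtain ⟨hb, rfl⟩ := hb
            refine ⟨Equiv.ofBijective (fun i => ⟨b i, by simp⟩) ⟨?_, ?_⟩, Finset.mem_univ _, rfl⟩
            · intro i j hij
              exact hb (congrArg Subtype.val hij)
            · rintro ⟨x, hx⟩
              obtain ⟨i, -, rfl⟩ := Finset.mem_image.1 hx
              exact ⟨i, rfl⟩
          · intro e _
            exact (Matrix.det_submatrix_equiv_self e _).symm
      _ = _ := by
          rw [Finset.sum_const, Finset.card_univ,
            Fintype.card_equiv (Fintype.equivOfCardEq (by simp [hs'])), Fintype.card_fin,
            nsmul_eq_mul]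
  · intro b hb
    simp only [Finset.mem_filter, Finset.mem_univ, true_and] at hb
    simp [Finset.mem_powersetCard, Finset.card_image_of_injective _ hb]

theorem sum_det_submatrix_eq_charpoly_coeff {α R : Type*} [Fintype α] [DecidableEq α] [CommRing R]
    (N : Matrix α α R) {m : ℕ} (hm : m ≤ Fintype.card α) :
    ∑ b : Fin m → α, (N.submatrix b b).det =
      (m.factorial : R) * (-N).charpoly.coeff (Fintype.card α - m) := by
  rw [sum_det_submatrix_eq_sum_minors, Matrix.charpoly_coeff_eq_sum_minors _ _ hm, Finset.mul_sum,
    Finset.mul_sum, Finset.mul_sum]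
  refine Finset.sum_congr rfl fun s hs => ?_
  have hs' : Fintype.card s = m := by
    rw [Fintype.card_coe]
    exact (Finset.mem_powersetCard.1 hs).2
  have h1 : (-1 : R) ^ m * (-1) ^ m = 1 := by rw [← mul_pow]; simp
  rw [Matrix.submatrix_neg, Pi.neg_apply, Pi.neg_apply, Matrix.det_neg, hs', ← mul_assoc (_ ^ m), h1,
    one_mul]

/-! ### Hook characters -/

/-- The matrix over `R` of the permutation `σ` acting on the standard basis. -/
def actionMatrix (R : Type*) [CommRing R] {α : Type*} [DecidableEq α] (σ : Equiv.Perm α) :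
    Matrix α α R :=
  Matrix.of fun x y => if σ y = x then 1 else 0

/-- The matrix of the rank one projection onto the basis vector at `p` along the sum zero
subspace. -/
def sumProjection (R : Type*) [CommRing R] {α : Type*} [DecidableEq α] (p : α) : Matrix α α R :=
  Matrix.of fun x _ => if p = x then 1 else 0

theorem differenceMatrix_cons {α : Type*} [DecidableEq α] (p : α) {m : ℕ} (b : Fin m → α) :
    differenceMatrix (Fin.cons p b) = (1 - sumProjection ℚ p).submatrix id b := by
  ext x j
  simp [differenceMatrix, sumProjection, Matrix.one_apply, eq_comm]

/-! ### Hook Specht modules and the generating function of their characters -/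

section

variable {α : Type*} [Fintype α] [DecidableEq α]

/-- The columns of a difference matrix have sum zero, and `1 - sumProjection ℚ p` is the identity on
the sum-zero subspace. -/
theorem mul_differenceMatrix (p : α) {m : ℕ} (f : Fin (m + 1) → α) :
    (1 - sumProjection ℚ p) * differenceMatrix f = differenceMatrix f := by
  rw [Matrix.sub_mul, Matrix.one_mul, sub_eq_self]
  ext x j
  simp [Matrix.mul_apply, sumProjection, differenceMatrix, Finset.sum_sub_distrib, mul_sub]

theorem differenceMatrix_perm_comp_cons (σ : Equiv.Perm α) (p : α) {m : ℕ} (b : Fin m → α) :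
    differenceMatrix (σ ∘ Fin.cons p b : Fin (m + 1) → α) =
      (actionMatrix ℚ σ * (1 - sumProjection ℚ p)).submatrix id b := by
  ext x j
  simp [differenceMatrix, sumProjection, actionMatrix, Matrix.mul_sub, Matrix.mul_apply]

open Classical in
/-- The coefficients of a formal sum of row assignments at the injective sequences. -/
def readCoefficients (α : Type*) (m : ℕ) : ((α → ℕ) →₀ ℚ) →ₗ[ℚ] ((Fin m → α) → ℚ) :=
  LinearMap.pi fun c => if Function.Injective c then Finsupp.lapply (rowsOf c) else 0

/-- Only injective sequences are recovered from their row assignment, which is why the others are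
read as zero; their minors have two equal rows and vanish too. -/
theorem readCoefficients_hookVector {m : ℕ} (f : Fin (m + 1) → α) (c : Fin m → α) :
    readCoefficients α m (hookVector f) c = ((differenceMatrix f).submatrix c id).det := by
  rw [readCoefficients, LinearMap.pi_apply]
  split_ifs with hc
  · rw [hookVector, Finsupp.lapply_apply, Finsupp.finsetSum_apply, Finset.sum_eq_single c]
    · simp
    · intro c' _ hne
      by_cases hc' : Function.Injective c'
      · rw [Finsupp.smul_apply, Finsupp.single_eq_of_ne, smul_zero]
        intro h
        exact hne (rowsOf_injOn hc hc' h).symm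
      · rw [det_submatrix_eq_zero_of_not_injective _ _ hc', zero_smul, Finsupp.zero_apply]
    · simp
  · rw [det_submatrix_eq_zero_of_not_injective _ _ hc, LinearMap.zero_apply]

/-- The linear map sending the basis vector at `b` to the multiple by `1 / m!` of the polytabloid
whose first column is `p, b 0, b 1, …`. -/
def polytabloidSum (p : α) (m : ℕ) : ((Fin m → α) → ℚ) →ₗ[ℚ] ((α → ℕ) →₀ ℚ) :=
  Fintype.linearCombination ℚ fun b : Fin m → α =>
    ((m.factorial : ℚ)⁻¹) • hookVector (Fin.cons p b : Fin (m + 1) → α)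

/-- This rewrites any polytabloid through those with corner entry `p`. At each `c` it is
Cauchy-Binet for the product of the projection and the difference matrix, which is the difference
matrix again; the `m!` comes from summing over sequences instead of subsets. -/
theorem polytabloidSum_readCoefficients (p : α) {m : ℕ} (f : Fin (m + 1) → α) :
    polytabloidSum p m (readCoefficients α m (hookVector f)) = hookVector f := by
  rw [polytabloidSum, Fintype.linearCombination_apply]
  simp only [readCoefficients_hookVector]
  simp only [hookVector, Finset.smul_sum, smul_smul]
  rw [Finset.sum_comm]
  refine Finset.sum_congr rfl fun c _ => ?_
  rw [← Finset.sum_smul]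
  congr 1
  have h := sum_det_submatrix_mul_det_submatrix ((1 - sumProjection ℚ p).submatrix c id)
    (differenceMatrix f)
  have h2 : (1 - sumProjection ℚ p).submatrix c id * differenceMatrix f
      = (differenceMatrix f).submatrix c id := by
    conv_rhs => rw [← mul_differenceMatrix p f]
    rfl
  rw [h2, Fintype.card_fin] at h
  have h3 : (m.factorial : ℚ) ≠ 0 := Nat.cast_ne_zero.2 m.factorial_ne_zero
  rw [← mul_right_inj' h3, ← h, Finset.mul_sum]
  refine Finset.sum_congr rfl fun b _ => ?_
  rw [differenceMatrix_cons]
  field_simp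
  rfl

theorem hookVector_mem_spechtModule {k m : ℕ} (hk : 1 ≤ k) (hα : Fintype.card α = k + m)
    (f : Fin (m + 1) → α) :
    hookVector f ∈ (spechtModule α (hookDiagram k m hk)).toSubmodule := by
  by_cases hf : Function.Injective f
  · obtain ⟨t, rfl⟩ := exists_tableau_firstColumn hk hα f hf
    rw [← polytabloid_eq_hookVector]
    exact Submodule.subset_span ⟨t, rfl⟩
  · rw [hookVector_eq_zero_of_not_injective hf]
    exact Submodule.zero_mem _

/-- Reading coefficients (`i`) and summing polytabloids (`j`) make the Specht module a retract of a
coordinate space, so the trace can be taken there. The diagonal entries are principal `m`-minors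
divided by `m!`, and their sum is the trace of an `m`-th exterior power, a coefficient of a
characteristic polynomial of index `n - m = k`. -/
theorem irreducibleCharacter_hookDiagram {k m : ℕ} (hk : 1 ≤ k) (hα : Fintype.card α = k + m)
    (p : α) (σ : Equiv.Perm α) :
    irreducibleCharacter (hookDiagram k m hk) σ
      = (-(actionMatrix ℚ σ * (1 - sumProjection ℚ p))).charpoly.coeff k := by
  let W := (spechtModule α (hookDiagram k m hk)).toSubmodule
  let i : W →ₗ[ℚ] ((Fin m → α) → ℚ) := readCoefficients α m ∘ₗ W.subtype
  have hj : ∀ φ, polytabloidSum p m φ ∈ W := by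
    intro φ
    rw [polytabloidSum, Fintype.linearCombination_apply]
    exact Submodule.sum_mem _ fun b _ => Submodule.smul_mem _ _ <| Submodule.smul_mem _ _ <|
      hookVector_mem_spechtModule hk hα _
  let j : ((Fin m → α) → ℚ) →ₗ[ℚ] W := (polytabloidSum p m).codRestrict W hj
  have hji : j ∘ₗ i = LinearMap.id := by
    ext w : 2
    obtain ⟨w, hw⟩ := w
    change polytabloidSum p m (readCoefficients α m w) = w
    induction hw using Submodule.span_induction with
    | mem x hx =>
      obtain ⟨t, rfl⟩ := hx
      change polytabloidSum p m (readCoefficients α m (polytabloid t)) = polytabloid t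
      rw [polytabloid_eq_hookVector, polytabloidSum_readCoefficients]
    | zero => simp
    | add x y _ _ hx hy => rw [map_add, map_add, hx, hy]
    | smul c x _ hx => rw [map_smul, map_smul, hx]
  -- Finiteness is needed to permute `i` and `T ∘ j` cyclically under the trace.
  have hfin : Module.Finite ℚ W := Module.Finite.of_surjective j fun w =>
    ⟨i w, LinearMap.congr_fun hji w⟩
  let T : W →ₗ[ℚ] W := (spechtModule α (hookDiagram k m hk)).toRepresentation σ
  have htrace : irreducibleCharacter (hookDiagram k m hk) σ
      = LinearMap.trace ℚ ((Fin m → α) → ℚ) (i ∘ₗ (T ∘ₗ j)) := by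
    rw [← LinearMap.trace_comp_comm', LinearMap.comp_assoc, hji]
    rfl
  have hentry : ∀ b : Fin m → α, (i ∘ₗ (T ∘ₗ j)) (Pi.single b 1) b = (m.factorial : ℚ)⁻¹ *
      ((actionMatrix ℚ σ * (1 - sumProjection ℚ p)).submatrix b b).det := by
    intro b
    change readCoefficients α m (rowAssignmentRep α σ (polytabloidSum p m (Pi.single b 1))) b = _
    rw [polytabloidSum, Fintype.linearCombination_apply_single, one_smul, map_smul,
      rowAssignmentRep_hookVector, map_smul, Pi.smul_apply, readCoefficients_hookVector,
      differenceMatrix_perm_comp_cons]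
    rfl
  rw [htrace, LinearMap.trace_eq_matrix_trace ℚ (Pi.basisFun ℚ (Fin m → α)), Matrix.trace]
  simp only [Matrix.diag_apply, LinearMap.toMatrix_apply, Pi.basisFun_apply, Pi.basisFun_repr,
    hentry]
  rw [← Finset.mul_sum, sum_det_submatrix_eq_charpoly_coeff _ (by omega), ← mul_assoc,
    inv_mul_cancel₀ (Nat.cast_ne_zero.2 m.factorial_ne_zero), one_mul]
  congr 1
  omega

theorem sumProjection_mul_self (R : Type*) [CommRing R] (p : α) :
    sumProjection R p * sumProjection R p = sumProjection R p := by
  ext x y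
  simp [Matrix.mul_apply, sumProjection]

theorem sumProjection_mul_actionMatrix (R : Type*) [CommRing R] (p : α) (σ : Equiv.Perm α) :
    sumProjection R p * actionMatrix R σ = sumProjection R p := by
  ext x y
  simp [Matrix.mul_apply, sumProjection, actionMatrix]

/-- With `E` the rank one projection and `A` the permutation matrix, `E * E = E` and `E * A = E`
give `(X + E) * (X + A - E) = X * (X + A)`. Moreover `A * (1 - E)` has the same characteristic
polynomial as `(1 - E) * A = A - E`. Taking determinants, `det (X + E) = X ^ (n - 1) * (X + 1)`, and
the factor `X ^ (n - 1)` cancels. -/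
theorem X_add_one_mul_charpoly (R : Type*) [CommRing R] (p : α) (σ : Equiv.Perm α) :
    (X + 1) * (-(actionMatrix R σ * (1 - sumProjection R p))).charpoly
      = X * (-actionMatrix R σ).charpoly := by
  set E := sumProjection R p with hE
  set A := actionMatrix R σ with hA
  have hE1 : (-E).charpoly = X ^ (Fintype.card α - 1) * (X + 1) := by
    have : -E = Matrix.vecMulVec (fun x => if p = x then -1 else 0) (fun _ => 1) := by
      ext x y
      simp [hE, sumProjection, Matrix.vecMulVec_apply, neg_ite]
    have hcard : Fintype.card α = Fintype.card α - 1 + 1 :=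
      (Nat.succ_pred_eq_of_pos (Fintype.card_pos_iff.2 ⟨p⟩)).symm
    rw [this, Matrix.charpoly_vecMulVec]
    conv_lhs => rw [hcard]
    simp [dotProduct]
    ring
  have hEE : E * E = E := sumProjection_mul_self R p
  have hEA : E * A = E := sumProjection_mul_actionMatrix R p σ
  have hcomm : (-(A * (1 - E))).charpoly = (-(A - E)).charpoly := by
    rw [← Matrix.neg_mul, Matrix.charpoly_mul_comm, Matrix.mul_neg, Matrix.sub_mul,
      Matrix.one_mul, hEA]
  have hprod : (-E).charmatrix * (-(A - E)).charmatrix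
      = (X : R[X]) • (-A).charmatrix := by
    have h0 : E.map C * (A - E).map C = 0 := by
      rw [← Matrix.map_mul, Matrix.mul_sub, hEE, hEA, sub_self]
      simp
    have h1 : ∀ B : Matrix α α R, (-B).charmatrix = Matrix.scalar α (X : R[X]) + B.map C := by
      intro B
      simp [Matrix.charmatrix, sub_eq_add_neg]
      ext
      simp
    have h2 : (A - E).map C = A.map C - E.map C := by
      ext
      simp
    rw [h1, h1, h1, Matrix.add_mul, Matrix.mul_add, Matrix.mul_add, h0, add_zero,
      (Matrix.scalar_commute X (fun r => Commute.all _ _) (E.map C)).eq.symm, add_assoc,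
      ← Matrix.mul_add, ← Matrix.mul_add, h2, sub_add_cancel, Matrix.scalar_apply,
      ← Matrix.smul_eq_diagonal_mul]
  have hdet := congrArg Matrix.det hprod
  rw [Matrix.det_mul, Matrix.det_smul] at hdet
  change (-E).charpoly * (-(A - E)).charpoly = _ * (-A).charpoly at hdet
  have hcard : Fintype.card α = Fintype.card α - 1 + 1 :=
      (Nat.succ_pred_eq_of_pos (Fintype.card_pos_iff.2 ⟨p⟩)).symm
  rw [hE1, hcard, Nat.add_sub_cancel, pow_succ, mul_assoc, mul_assoc] at hdet
  rw [hcomm]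
  exact (isRegular_X_pow _).left.eq_iff.1 hdet

end

/-! ### Hook immanants as coefficients -/

section

variable {A : Type*} [CommRing A]

/-- The coefficient of `X ^ k` in the power series `X * f / (1 + X)`. -/
def hookCoeffNat : ℕ → A[X] →ₗ[A] A
  | 0 => 0
  | k + 1 => lcoeff A k - hookCoeffNat k

theorem hookCoeffNat_succ (k : ℕ) (f : A[X]) :
    hookCoeffNat (k + 1) f = f.coeff k - hookCoeffNat k f := rfl

/-- Comparing coefficients in `(X + 1) * g = X * f` gives the recursion that defines `hookCoeffNat`,
so no power series are needed. -/
theorem hookCoeffNat_eq_coeff {f g : A[X]} (h : (X + 1) * g = X * f) (k : ℕ) :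
    hookCoeffNat k f = g.coeff k := by
  induction k with
  | zero =>
    have := congrArg (fun p => p.coeff 0) h
    simp [add_mul] at this
    exact this.symm
  | succ k ih =>
    have := congrArg (fun p => p.coeff (k + 1)) h
    simp [add_mul] at this
    rw [hookCoeffNat_succ, ih, ← this, add_sub_cancel_left]

theorem hookCoeffNat_map {B : Type*} [CommRing B] (φ : A →+* B) (f : A[X]) (k : ℕ) :
    hookCoeffNat k (f.map φ) = φ (hookCoeffNat k f) := by
  induction k with
  | zero => exact (map_zero φ).symm
  | succ k ih => rw [hookCoeffNat_succ, hookCoeffNat_succ, coeff_map, ih, map_sub]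

theorem hookCoeffNat_X_mul (f : A[X]) (k : ℕ) :
    hookCoeffNat (k + 1) (X * f) = hookCoeffNat k f := by
  induction k with
  | zero => simp [hookCoeffNat]
  | succ k ih => rw [hookCoeffNat_succ, ih, coeff_X_mul, hookCoeffNat_succ]

/-- The expansion of `X / (1 + X)`, which is the convention for the empty matrix. -/
theorem hookCoeffNat_one (k : ℕ) : hookCoeffNat (k + 1) (1 : A[X]) = (-1) ^ k := by
  induction k with
  | zero => simp [hookCoeffNat]
  | succ k ih =>
    rw [hookCoeffNat_succ, ih, coeff_one, if_neg (Nat.succ_ne_zero k), pow_succ]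
    ring

/-- The coefficient of `X ^ k` in the power series `X * f / (1 + X)`, for an integer `k`. -/
def hookCoeff (k : ℤ) : A[X] →ₗ[A] A := if 0 ≤ k then hookCoeffNat k.toNat else 0

theorem hookCoeff_of_neg {k : ℤ} (hk : k < 0) (f : A[X]) : hookCoeff k f = 0 := by
  rw [hookCoeff, if_neg (by omega), LinearMap.zero_apply]

theorem hookCoeff_natCast (k : ℕ) (f : A[X]) : hookCoeff k f = hookCoeffNat k f := by
  rw [hookCoeff, if_pos (by omega), Int.toNat_natCast]

theorem hookCoeff_X_mul (k : ℤ) (f : A[X]) : hookCoeff k (X * f) = hookCoeff (k - 1) f := by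
  rcases lt_trichotomy k 0 with hk | rfl | hk
  · rw [hookCoeff_of_neg hk, hookCoeff_of_neg (by omega)]
  · rw [hookCoeff_of_neg (k := 0 - 1) (by omega)]
    rfl
  · obtain ⟨j, rfl⟩ : ∃ j : ℕ, k = (j + 1 : ℕ) := ⟨(k - 1).toNat, by omega⟩
    rw [hookCoeff_natCast, hookCoeffNat_X_mul, ← hookCoeff_natCast]
    congr 2
    omega

theorem hookCoeff_X_pow_mul (k : ℤ) (l : ℕ) (f : A[X]) :
    hookCoeff k (X ^ l * f) = hookCoeff (k - l) f := by
  induction l generalizing k with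
  | zero => simp
  | succ l ih =>
    rw [pow_succ', mul_assoc, hookCoeff_X_mul, ih]
    congr 2
    push_cast
    ring

theorem hookCoeff_C_mul (k : ℤ) (a : A) (f : A[X]) : hookCoeff k (C a * f) = a * hookCoeff k f := by
  rw [← smul_eq_C_mul, map_smul, smul_eq_mul]

/-- The generating polynomial `∑ σ, det (X + P_σ) ∏ i, M i (σ i)`, where `P_σ` is the permutation
matrix of `σ`. -/
def immanantPoly {α : Type*} [Fintype α] [DecidableEq α] (M : Matrix α α A) : A[X] :=
  ∑ σ : Equiv.Perm α, C (∏ i, M i (σ i)) * (-actionMatrix A σ).charpoly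

theorem hookImmanant_eq_hookCoeff [Algebra ℚ A] {α : Type*} [Fintype α] [DecidableEq α] (k : ℤ)
    (M : Matrix α α A) : hookImmanant k M = hookCoeff k (immanantPoly M) := by
  rw [hookImmanant]
  split_ifs with h0 hk hk
  · have : IsEmpty α := Fintype.card_eq_zero_iff.1 h0
    obtain ⟨j, rfl⟩ : ∃ j : ℕ, k = (j + 1 : ℕ) := ⟨(k - 1).toNat, by omega⟩
    have h1 : immanantPoly M = 1 := by
      simp [immanantPoly, Matrix.charpoly]
    rw [h1, hookCoeff_natCast, hookCoeffNat_one]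
    congr 1
    omega
  · rw [hookCoeff]
    split_ifs with hk'
    · rw [show k.toNat = 0 by omega]
      rfl
    · rfl
  · obtain ⟨j, rfl⟩ : ∃ j : ℕ, k = (j : ℕ) := ⟨k.toNat, by omega⟩
    obtain ⟨p⟩ : Nonempty α := Fintype.card_pos_iff.1 (Nat.pos_of_ne_zero h0)
    rw [hookCoeff_natCast, immanant, immanantPoly, map_sum]
    refine Finset.sum_congr rfl fun σ _ => ?_
    rw [irreducibleCharacter_hookDiagram _ (by omega) p, ← hookCoeffNat_eq_coeff
      (X_add_one_mul_charpoly ℚ p σ), ← smul_eq_C_mul, map_smul, smul_eq_mul, Algebra.smul_def,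
      mul_comm]
    congr 1
    have : -actionMatrix A σ = (-actionMatrix ℚ σ).map (algebraMap ℚ A) := by
      ext x y
      simp [actionMatrix, apply_ite (algebraMap ℚ A)]
    rw [this, Matrix.charpoly_map, hookCoeffNat_map]
    rfl
  · obtain ⟨p⟩ : Nonempty α := Fintype.card_pos_iff.1 (Nat.pos_of_ne_zero h0)
    symm
    by_cases hk0 : k < 0
    · exact hookCoeff_of_neg hk0 _
    obtain ⟨j, rfl⟩ : ∃ j : ℕ, k = (j : ℕ) := ⟨k.toNat, by omega⟩
    rw [hookCoeff_natCast, immanantPoly, map_sum]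
    refine Finset.sum_eq_zero fun σ _ => ?_
    rw [← smul_eq_C_mul, map_smul]
    suffices hookCoeffNat j (-actionMatrix A σ).charpoly = 0 by rw [this, smul_zero]
    rcases Nat.eq_zero_or_pos j with rfl | hj
    · rfl
    · nontriviality A
      -- The quotient is a characteristic polynomial of degree `n`, and here `n < j`.
      rw [hookCoeffNat_eq_coeff (X_add_one_mul_charpoly A p σ)]
      apply coeff_eq_zero_of_natDegree_lt
      rw [Matrix.charpoly_natDegree_eq_dim]
      omega

end

/-! ### Expansion along the cycle through a point -/

section

variable {A : Type*} [CommRing A] {α : Type*} [Fintype α] [DecidableEq α]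

theorem charmatrix_neg_actionMatrix (σ : Equiv.Perm α) (i j : α) :
    (-actionMatrix A σ).charmatrix i j = (if i = j then X else 0) + if σ j = i then 1 else 0 := by
  rw [Matrix.charmatrix_apply, Matrix.diagonal_apply]
  simp [actionMatrix, apply_ite C]

/-- In the Leibniz expansion a permutation survives only if it sends each `j` to `j` or `c j`. One
point sent to `c j` forces, by injectivity along the cycle, agreement with `c` everywhere. The two
survivors `1` and `c` give `X ^ n` and the sign of `c`. -/
theorem charpoly_neg_actionMatrix_of_isCycle (c : Equiv.Perm α) (hc : c.IsCycle)
    (hsupp : c.support = Finset.univ) :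
    (-actionMatrix A c).charpoly = X ^ Fintype.card α - (-1) ^ Fintype.card α := by
  have hmove : ∀ x, c x ≠ x := fun x => by
    rw [← Equiv.Perm.mem_support, hsupp]
    exact Finset.mem_univ x
  have hterm : ∀ τ : Equiv.Perm α, (∀ j, τ j = j ∨ c j = τ j) → τ = 1 ∨ τ = c := by
    intro τ hτ
    by_cases h : ∃ j, c j = τ j
    · right
      obtain ⟨j, hj⟩ := h
      have hpow : ∀ n : ℕ, c ((c ^ n) j) = τ ((c ^ n) j) := by
        intro n
        induction n with
        | zero => exact hj
        | succ n ih =>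
          rw [pow_succ', Equiv.Perm.mul_apply]
          rcases hτ (c ((c ^ n) j)) with h1 | h1
          · rw [ih] at h1
            have := τ.injective h1
            rw [← ih] at this
            exact absurd this (hmove _)
          · exact h1
      ext x
      obtain ⟨n, rfl⟩ := (hc.sameCycle (hmove j) (hmove x)).exists_nat_pow_eq
      exact (hpow n).symm
    · left
      push Not at h
      ext x
      exact (hτ x).resolve_right (h x)
  have hne : (1 : Equiv.Perm α) ≠ c := hc.ne_one.symm
  rw [Matrix.charpoly, Matrix.det_apply', Fintype.sum_eq_add 1 c hne]
  · have h1 : ∏ i, (-actionMatrix A c).charmatrix ((1 : Equiv.Perm α) i) i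
        = (X : A[X]) ^ Fintype.card α := by
      rw [Finset.prod_congr rfl fun i _ => (?_ : _ = (X : A[X]))]
      · simp
      · rw [charmatrix_neg_actionMatrix, Equiv.Perm.one_apply, if_pos rfl, if_neg (hmove i),
          add_zero]
    have h2 : ∏ i, (-actionMatrix A c).charmatrix (c i) i = 1 := by
      refine Finset.prod_eq_one fun i _ => ?_
      rw [charmatrix_neg_actionMatrix, if_neg (hmove i), if_pos rfl, zero_add]
    rw [h1, h2, hc.sign, hsupp, Finset.card_univ]
    simp [sub_eq_add_neg]
  · rintro τ ⟨h1, h2⟩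
    by_contra h
    have hprod : ∏ i, (-actionMatrix A c).charmatrix (τ i) i ≠ 0 := right_ne_zero_of_mul h
    have := hterm τ fun j => by
      by_contra hj
      push Not at hj
      refine hprod (Finset.prod_eq_zero (Finset.mem_univ j) ?_)
      rw [charmatrix_neg_actionMatrix, if_neg hj.1, if_neg hj.2, add_zero]
    tauto

theorem charpoly_neg_actionMatrix_of_card_eq_one (c : Equiv.Perm α) (h : Fintype.card α = 1) :
    (-actionMatrix A c).charpoly = X ^ Fintype.card α - (-1) ^ Fintype.card α := by
  have : Subsingleton α := Fintype.card_le_one_iff_subsingleton.1 h.le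
  obtain ⟨p⟩ : Nonempty α := Fintype.card_pos_iff.1 (by omega)
  rw [Matrix.charpoly, Matrix.det_eq_elem_of_card_eq_one h p, charmatrix_neg_actionMatrix, h,
    if_pos rfl, if_pos (Subsingleton.elim _ _)]
  simp

/-- The orbit of `v` under a permutation that is either the identity or a cycle moving `v`. -/
def cycleSupport (v : α) (c : Equiv.Perm α) : Finset α := insert v c.support

theorem apply_mem_cycleSupport_iff (v : α) (c : Equiv.Perm α) (x : α) :
    c x ∈ cycleSupport v c ↔ x ∈ cycleSupport v c := by
  by_cases hx : c x = x
  · rw [hx]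
  · have h1 : x ∈ c.support := Equiv.Perm.mem_support.2 hx
    exact ⟨fun _ => Finset.mem_insert_of_mem h1,
      fun _ => Finset.mem_insert_of_mem (Equiv.Perm.apply_mem_support.2 h1)⟩

theorem apply_eq_of_notMem_cycleSupport {v : α} {c : Equiv.Perm α} {x : α}
    (hx : x ∉ cycleSupport v c) : c x = x := by
  by_contra h
  exact hx (Finset.mem_insert_of_mem (Equiv.Perm.mem_support.2 h))

theorem charpoly_neg_actionMatrix_subtypePerm (v : α) {c : Equiv.Perm α} (hc : c.cycleOf v = c) :
    (-actionMatrix A (c.subtypePerm (apply_mem_cycleSupport_iff v c))).charpoly =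
      X ^ (cycleSupport v c).card - (-1) ^ (cycleSupport v c).card := by
  have hcard : (cycleSupport v c).card = Fintype.card {x // x ∈ cycleSupport v c} :=
    (Fintype.card_coe _).symm
  by_cases hcv : c v = v
  · have hc1 : c = 1 := by rw [← hc, Equiv.Perm.cycleOf_eq_one_iff, hcv]
    have h1 : (cycleSupport v c).card = 1 := by
      rw [cycleSupport, hc1]
      simp
    rw [charpoly_neg_actionMatrix_of_card_eq_one _ (hcard.symm.trans h1), ← hcard]
  · have hcyc : c.IsCycle := by
      rw [← hc]
      exact Equiv.Perm.isCycle_cycleOf c hcv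
    have hsub : ∀ x, x ∈ cycleSupport v c → c x ≠ x := by
      intro x hx
      rcases Finset.mem_insert.1 hx with rfl | hx
      · exact hcv
      · exact Equiv.Perm.mem_support.1 hx
    rw [hcard]
    refine charpoly_neg_actionMatrix_of_isCycle _ ⟨⟨v, Finset.mem_insert_self _ _⟩, ?_, ?_⟩ ?_
    · simpa [Subtype.ext_iff] using hcv
    · rintro ⟨y, hy⟩ _
      obtain ⟨n, hn⟩ := (hcyc.sameCycle hcv (hsub y hy)).exists_nat_pow_eq
      refine ⟨n, ?_⟩
      rw [zpow_natCast, Equiv.Perm.subtypePerm_pow, Subtype.ext_iff]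
      exact hn
    · ext ⟨x, hx⟩
      simpa [Subtype.ext_iff] using hsub x hx

/-- The permutation preserves the orbit of `v` and its complement, so the matrix is block triangular
with one block for each. -/
theorem charpoly_neg_actionMatrix_mul (v : α) {c : Equiv.Perm α} (hc : c.cycleOf v = c)
    (τ : Equiv.Perm {x // x ∉ cycleSupport v c}) :
    (-actionMatrix A (c * Equiv.Perm.ofSubtype τ)).charpoly =
      (X ^ (cycleSupport v c).card - (-1) ^ (cycleSupport v c).card)
        * (-actionMatrix A τ).charpoly := by
  have hτ : ∀ x, x ∈ cycleSupport v c → Equiv.Perm.ofSubtype τ x = x := fun x hx =>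
    Equiv.Perm.ofSubtype_apply_of_not_mem τ (not_not.2 hx)
  have hτ' : ∀ x : {x // x ∉ cycleSupport v c}, Equiv.Perm.ofSubtype τ x = τ x := fun x =>
    Equiv.Perm.ofSubtype_apply_coe τ x
  have h1 : Matrix.toSquareBlockProp
      (-actionMatrix A (c * Equiv.Perm.ofSubtype τ)).charmatrix (fun x => x ∈ cycleSupport v c)
      = (-actionMatrix A (c.subtypePerm (apply_mem_cycleSupport_iff v c))).charmatrix := by
    ext1 i j
    rw [Matrix.toSquareBlockProp_def, Matrix.of_apply, charmatrix_neg_actionMatrix,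
      charmatrix_neg_actionMatrix, Equiv.Perm.mul_apply, hτ _ j.2]
    simp only [Subtype.ext_iff, Equiv.Perm.subtypePerm_apply]
  have h2 : Matrix.toSquareBlockProp
      (-actionMatrix A (c * Equiv.Perm.ofSubtype τ)).charmatrix (fun x => ¬ x ∈ cycleSupport v c)
      = (-actionMatrix A τ).charmatrix := by
    ext1 i j
    rw [Matrix.toSquareBlockProp_def, Matrix.of_apply, charmatrix_neg_actionMatrix,
      charmatrix_neg_actionMatrix, Equiv.Perm.mul_apply, hτ',
      apply_eq_of_notMem_cycleSupport (τ j).2]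
    simp only [Subtype.ext_iff]
  rw [Matrix.charpoly, Matrix.twoBlockTriangular_det _ (fun x => x ∈ cycleSupport v c), h1, h2,
    ← charpoly_neg_actionMatrix_subtypePerm v hc,
    Matrix.charpoly, Matrix.charpoly]
  · congr!
  · intro i hi j hj
    have h1 : i ≠ j := fun h => hi (h ▸ hj)
    have h2 : c j ≠ i := fun h => hi (h ▸ (apply_mem_cycleSupport_iff v c j).2 hj)
    rw [charmatrix_neg_actionMatrix, if_neg h1, Equiv.Perm.mul_apply, hτ j hj, if_neg h2, add_zero]

/-- The generating polynomial of the principal submatrix obtained by deleting `S`. -/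
def immanantPolyCompl (M : Matrix α α A) (S : Finset α) : A[X] :=
  immanantPoly (M.submatrix (Subtype.val : {x // x ∉ S} → α) Subtype.val)

/-- Permutations are grouped by their cycle `c` through `v`. The group of `c` consists of the
products `c * τ` with `τ` a permutation of the complement of the orbit, and both the entry product
and the characteristic polynomial factor. -/
theorem immanantPoly_eq_sum_cycles (M : Matrix α α A) (v : α) :
    immanantPoly M = ∑ c : Equiv.Perm α with c.cycleOf v = c,
      C (∏ x ∈ cycleSupport v c, M x (c x)) *
        ((X ^ (cycleSupport v c).card - (-1) ^ (cycleSupport v c).card)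
          * immanantPolyCompl M (cycleSupport v c)) := by
  rw [immanantPoly, ← Finset.sum_fiberwise_of_maps_to (g := fun σ : Equiv.Perm α => σ.cycleOf v)
    (t := {c : Equiv.Perm α | c.cycleOf v = c})]
  · refine Finset.sum_congr rfl fun c hc => ?_
    rw [Finset.mem_filter_univ] at hc
    have hfix : ∀ x, x ∉ cycleSupport v c → c x = x := fun x hx =>
      apply_eq_of_notMem_cycleSupport hx
    rw [immanantPolyCompl, immanantPoly, Finset.mul_sum, Finset.mul_sum]
    symm
    refine Finset.sum_bij
      (fun (τ : Equiv.Perm {x // x ∉ cycleSupport v c}) _ => c * Equiv.Perm.ofSubtype τ) ?_ ?_ ?_ ?_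
    · intro τ _
      rw [Finset.mem_filter_univ]
      have hdisj : ∀ x, c x = x ∨ Equiv.Perm.ofSubtype τ x = x := by
        intro x
        by_cases hx : x ∈ cycleSupport v c
        · exact Or.inr (Equiv.Perm.ofSubtype_apply_of_not_mem τ (not_not.2 hx))
        · exact Or.inl (hfix x hx)
      rw [Equiv.Perm.cycleOf_mul_of_apply_right_eq_self, hc]
      · exact Equiv.Perm.Disjoint.commute hdisj
      · exact Equiv.Perm.ofSubtype_apply_of_not_mem τ (not_not.2 (Finset.mem_insert_self _ _))
    · intro τ _ τ' _ h
      exact Equiv.Perm.ofSubtype_injective (mul_left_cancel h)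
    · intro σ hσ
      rw [Finset.mem_filter_univ] at hσ
      have hσc : ∀ x ∈ cycleSupport v c, σ x = c x := by
        intro x hx
        have : σ.SameCycle v x := by
          rcases Finset.mem_insert.1 hx with rfl | hx
          · exact Equiv.Perm.SameCycle.refl _ _
          · rw [← hσ, Equiv.Perm.mem_support_cycleOf_iff] at hx
            exact hx.1
        rw [← hσ, this.cycleOf_apply]
      have hρ : ∀ x, ¬ x ∉ cycleSupport v c → (c⁻¹ * σ) x = x := by
        intro x hx
        rw [Equiv.Perm.mul_apply, hσc x (not_not.1 hx), Equiv.Perm.inv_eq_iff_eq]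
      refine ⟨(Equiv.Perm.subtypeEquivSubtypePerm (fun x => x ∉ cycleSupport v c)).symm
        ⟨c⁻¹ * σ, hρ⟩, Finset.mem_univ _, ?_⟩
      have := congrArg Subtype.val
        ((Equiv.Perm.subtypeEquivSubtypePerm (fun x => x ∉ cycleSupport v c)).apply_symm_apply
        ⟨c⁻¹ * σ, hρ⟩)
      rw [Equiv.Perm.subtypeEquivSubtypePerm_apply_coe] at this
      rw [this, mul_inv_cancel_left]
    · intro τ _
      rw [charpoly_neg_actionMatrix_mul v hc]
      have hprod : ∏ i, M i ((c * Equiv.Perm.ofSubtype τ) i) =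
          (∏ x ∈ cycleSupport v c, M x (c x)) *
            ∏ i : {x // x ∉ cycleSupport v c}, M i (τ i) := by
        rw [← Finset.prod_mul_prod_compl (cycleSupport v c)]
        congr 1
        · refine Finset.prod_congr rfl fun x hx => ?_
          rw [Equiv.Perm.mul_apply, Equiv.Perm.ofSubtype_apply_of_not_mem τ (not_not.2 hx)]
        · rw [Finset.prod_subtype (p := fun x => x ∉ cycleSupport v c) _
            fun x => by rw [Finset.mem_compl]]
          refine Finset.prod_congr rfl fun x _ => ?_
          rw [Equiv.Perm.mul_apply, Equiv.Perm.ofSubtype_apply_coe, hfix _ (τ x).2]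
      rw [hprod, C_mul]
      simp only [Matrix.submatrix_apply]
      ring
  · intro σ _
    rw [Finset.mem_filter_univ]
    by_cases h : σ v = v
    · rw [(Equiv.Perm.cycleOf_eq_one_iff σ).2 h, Equiv.Perm.cycleOf_one]
    · have := Equiv.Perm.isCycle_cycleOf σ h
      exact this.cycleOf_eq (by rwa [Equiv.Perm.cycleOf_apply_self])

end

/-! ### Cyclic permutations and cycles of a graph -/

section

variable {V : Type*} {G : SimpleGraph V}

/-- The subgraph of `G` with an edge from `x` to `c x` for every `x` moved by `c`, wherever that is
an edge of `G`. -/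
def permSubgraph (G : SimpleGraph V) (c : Equiv.Perm V) : G.Subgraph where
  verts := {x | c x ≠ x}
  Adj a b := G.Adj a b ∧ (c a = b ∨ c b = a)
  adj_sub h := h.1
  edge_vert := by
    rintro a b ⟨h, h' | h'⟩ ha
    · exact h.ne (ha.symm.trans h')
    · exact h.ne (c.injective (ha.trans h'.symm))
  symm := ⟨fun a b h => ⟨h.1.symm, h.2.symm⟩⟩

theorem permSubgraph_inv (c : Equiv.Perm V) : permSubgraph G c⁻¹ = permSubgraph G c := by
  ext a b
  · simp only [permSubgraph, Set.mem_ofPred_eq, ne_eq]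
    rw [Equiv.Perm.inv_eq_iff_eq, eq_comm]
  · simp only [permSubgraph]
    rw [Equiv.Perm.inv_eq_iff_eq, Equiv.Perm.inv_eq_iff_eq, or_comm, @eq_comm _ b,
      @eq_comm _ a (c b)]

theorem permSubgraph_eq_toSubgraph {x : V} (p : G.Walk x x) (c : Equiv.Perm V)
    (h : ∀ i < p.length, c (p.getVert i) = p.getVert (i + 1))
    (hc : ∀ y, c y ≠ y → ∃ i < p.length, p.getVert i = y) (hp : 0 < p.length) :
    permSubgraph G c = p.toSubgraph := by
  ext a b
  · simp only [permSubgraph, Set.mem_ofPred_eq, SimpleGraph.Walk.verts_toSubgraph]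
    constructor
    · intro ha
      obtain ⟨i, -, rfl⟩ := hc a ha
      exact p.getVert_mem_support i
    · intro ha
      rw [SimpleGraph.Walk.mem_support_iff_exists_getVert] at ha
      obtain ⟨i, rfl, hi⟩ := ha
      rcases hi.lt_or_eq with hi | hi
      · rw [h i hi]
        exact (p.adj_getVert_succ hi).ne'
      -- The last vertex of the closed walk is its first one, so its successor is read at index `0`.
      · have h0 := h 0 hp
        have h1 := p.adj_getVert_succ hp
        rw [hi, p.getVert_length]
        rw [p.getVert_zero] at h0 h1
        rw [h0]
        exact h1.ne'
  · rw [SimpleGraph.Walk.toSubgraph_adj_iff]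
    simp only [permSubgraph, Sym2.eq_iff]
    constructor
    · rintro ⟨hab, rfl | rfl⟩
      · obtain ⟨i, hi, rfl⟩ := hc a hab.ne'
        exact ⟨i, Or.inl ⟨rfl, (h i hi).symm⟩, hi⟩
      · obtain ⟨i, hi, rfl⟩ := hc b hab.ne
        exact ⟨i, Or.inr ⟨rfl, (h i hi).symm⟩, hi⟩
    · rintro ⟨i, ⟨rfl, rfl⟩ | ⟨rfl, rfl⟩, hi⟩
      · exact ⟨p.adj_getVert_succ hi, Or.inl (h i hi)⟩
      · exact ⟨(p.adj_getVert_succ hi).symm, Or.inr (h i hi)⟩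

theorem exists_walk_of_perm (c : Equiv.Perm V) (n : ℕ) : ∀ x y : V, (c ^ n) x = y →
    (∀ i : ℕ, G.Adj ((c ^ i) x) (c ((c ^ i) x))) →
    ∃ p : G.Walk x y, p.length = n ∧ ∀ i ≤ n, p.getVert i = (c ^ i) x := by
  induction n with
  | zero =>
    rintro x y rfl _
    refine ⟨SimpleGraph.Walk.nil, rfl, fun i hi => ?_⟩
    rw [Nat.le_zero.1 hi]
    rfl
  | succ n ih =>
    intro x y hxy hadj
    obtain ⟨p, hp, hv⟩ := ih (c x) y (by rw [← hxy, pow_succ, Equiv.Perm.mul_apply])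
      fun i => by simpa only [pow_succ, Equiv.Perm.mul_apply] using hadj (i + 1)
    have h0 : G.Adj x (c x) := hadj 0
    refine ⟨SimpleGraph.Walk.cons h0 p, by simp [hp], fun i hi => ?_⟩
    rcases i with _ | i
    · simp
    · rw [SimpleGraph.Walk.getVert_cons_succ, hv i (by omega), pow_succ, Equiv.Perm.mul_apply]

/-! ### Cyclic permutations as oriented graph cycles -/

variable [Fintype V] [DecidableEq V]

/-- The permutation `c` is a cycle of length at least three that moves along the edges of `G`. -/
structure IsGraphCycle (G : SimpleGraph V) (c : Equiv.Perm V) : Prop where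
  isCycle : c.IsCycle
  three_le : 3 ≤ c.support.card
  adj : ∀ x, c x ≠ x → G.Adj x (c x)

namespace IsGraphCycle

variable {c c' : Equiv.Perm V}

theorem apply_apply_ne (h : IsGraphCycle G c) {x : V} (hx : c x ≠ x) : c (c x) ≠ x := by
  intro hxx
  have h2 : c ^ 2 = 1 := (h.isCycle.pow_eq_one_iff' hx).2 (by simpa [pow_two] using hxx)
  have h3 := orderOf_le_of_pow_eq_one two_pos h2
  rw [h.isCycle.orderOf] at h3
  exact absurd (h.three_le.trans h3) (by norm_num)

theorem inv (h : IsGraphCycle G c) : IsGraphCycle G c⁻¹ where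
  isCycle := h.isCycle.inv
  three_le := by rw [Equiv.Perm.support_inv]; exact h.three_le
  adj x hx := by
    have h1 : c (c⁻¹ x) = x := c.apply_symm_apply x
    have h2 := h.adj (c⁻¹ x) (by rw [h1]; exact hx.symm)
    rw [h1] at h2
    exact h2.symm

theorem inv_ne (h : IsGraphCycle G c) : c⁻¹ ≠ c := by
  intro heq
  obtain ⟨x, hx, -⟩ := h.isCycle
  refine h.apply_apply_ne hx ?_
  have h1 : c (c⁻¹ x) = x := c.apply_symm_apply x
  rwa [heq] at h1

/-- At each moved `x`, `c' x` is the successor or the predecessor of `x` under `c`. If it is the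
successor once, it stays so along the whole cycle, because `c'` cannot turn back; otherwise it is
always the predecessor. -/
theorem eq_or_eq_inv (h : IsGraphCycle G c) (h' : IsGraphCycle G c')
    (heq : permSubgraph G c' = permSubgraph G c) : c' = c ∨ c' = c⁻¹ := by
  have hsupp : ∀ x, c' x ≠ x ↔ c x ≠ x := fun x =>
    Set.ext_iff.1 (congrArg SimpleGraph.Subgraph.verts heq) x
  have hadj : ∀ x, c x ≠ x → c x = c' x ∨ c (c' x) = x := by
    intro x hx
    have : (permSubgraph G c').Adj x (c' x) := ⟨h'.adj x ((hsupp x).2 hx), Or.inl rfl⟩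
    rw [heq] at this
    exact this.2
  by_cases hex : ∃ x, c x ≠ x ∧ c x = c' x
  · left
    obtain ⟨x, hx, hxc⟩ := hex
    have hpow : ∀ n : ℕ, c ((c ^ n) x) ≠ (c ^ n) x ∧ c ((c ^ n) x) = c' ((c ^ n) x) := by
      intro n
      induction n with
      | zero => exact ⟨hx, hxc⟩
      | succ n ih =>
        rw [pow_succ', Equiv.Perm.mul_apply]
        have hmove : c (c ((c ^ n) x)) ≠ c ((c ^ n) x) := fun h => ih.1 (c.injective h)
        refine ⟨hmove, (hadj _ hmove).resolve_right fun hback => ?_⟩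
        have h1 : c' (c ((c ^ n) x)) = (c ^ n) x := c.injective hback
        rw [ih.2] at h1
        exact h'.apply_apply_ne ((hsupp _).2 ih.1) h1
    ext y
    by_cases hy : c y = y
    · rw [hy]
      by_contra hne
      exact (hsupp y).1 hne hy
    · obtain ⟨n, rfl⟩ := (h.isCycle.sameCycle hx hy).exists_nat_pow_eq
      exact (hpow n).2.symm
  · right
    push Not at hex
    ext y
    rw [eq_comm, Equiv.Perm.inv_eq_iff_eq, eq_comm]
    by_cases hy : c y = y
    · have : c' y = y := by
        by_contra hne
        exact (hsupp y).1 hne hy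
      rw [this, hy]
    · exact (hadj y hy).resolve_left (hex y hy)

theorem isCycleSubgraph (h : IsGraphCycle G c) : IsCycleSubgraph (permSubgraph G c) := by
  obtain ⟨x, hx, hx'⟩ := id h.isCycle
  have hmove : ∀ i : ℕ, c ((c ^ i) x) ≠ (c ^ i) x := by
    intro i hi
    rw [← Equiv.Perm.mul_apply, ← pow_succ', pow_succ, Equiv.Perm.mul_apply] at hi
    exact hx ((c ^ i).injective hi)
  obtain ⟨p, hp, hv⟩ := exists_walk_of_perm (G := G) c (orderOf c) x x
    (by rw [pow_orderOf_eq_one]; rfl) fun i => h.adj _ (hmove i)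
  have hlen : 3 ≤ p.length := by
    rw [hp, h.isCycle.orderOf]
    exact h.three_le
  refine ⟨x, p, ?_, (permSubgraph_eq_toSubgraph p c ?_ ?_ (by omega)).symm⟩
  · rw [SimpleGraph.Walk.isCycle_iff_isPath_tail_and_le_length]
    refine ⟨?_, hlen⟩
    rw [← SimpleGraph.Walk.IsPath.getVert_injOn_iff]
    have htail : p.tail.length + 1 = p.length :=
      SimpleGraph.Walk.length_tail_add_one (SimpleGraph.Walk.not_nil_iff_lt_length.2 (by omega))
    intro i hi j hj hij
    simp only [Set.mem_ofPred_eq] at hi hj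
    rw [SimpleGraph.Walk.getVert_tail, SimpleGraph.Walk.getVert_tail, hv _ (by omega),
      hv _ (by omega)] at hij
    have h1 : c ^ (i + 1) = c ^ (j + 1) := h.isCycle.pow_eq_pow_iff.2 ⟨x, hx, hij⟩
    rw [pow_succ, pow_succ] at h1
    exact pow_injOn_Iio_orderOf (Set.mem_Iio.2 (by omega)) (Set.mem_Iio.2 (by omega))
      (mul_right_cancel h1)
  · intro i hi
    rw [hv i (by omega), hv (i + 1) (by omega), pow_succ', Equiv.Perm.mul_apply]
  · intro y hy
    obtain ⟨n, rfl⟩ := (hx' hy).exists_nat_pow_eq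
    have hn : n % orderOf c < orderOf c := Nat.mod_lt _ (by omega)
    exact ⟨n % orderOf c, by omega, by rw [hv _ hn.le, pow_mod_orderOf]⟩

end IsGraphCycle

/-- The support of a cycle lists the base point twice; its tail has no repetition and is turned into
a cyclic permutation by `List.formPerm`. -/
theorem exists_isGraphCycle_of_isCycleSubgraph {Z : G.Subgraph} (hZ : IsCycleSubgraph Z) :
    ∃ c, IsGraphCycle G c ∧ permSubgraph G c = Z := by
  obtain ⟨x, p, hp, rfl⟩ := hZ
  have hlen := hp.three_le_length
  have hnd := hp.support_nodup
  have hl : p.support.tail.length = p.length := by simp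
  have hget : ∀ i (hi : i < p.support.tail.length), p.support.tail[i] = p.getVert (i + 1) := by
    intro i hi
    rw [List.getElem_tail, SimpleGraph.Walk.support_getElem_eq_getVert]
  set c := p.support.tail.formPerm with hc
  have hstep : ∀ i < p.length, c (p.getVert i) = p.getVert (i + 1) := by
    intro i hi
    rcases i with _ | i
    -- The base point sits last in the tail, so its step is the wrap-around of `formPerm`.
    · have h1 := List.formPerm_apply_getElem _ hnd (p.length - 1) (by omega)
      rw [hget, hget, ← hc] at h1
      rw [show p.length - 1 + 1 = p.length by omega, p.getVert_length, hl, Nat.mod_self] at h1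
      rw [p.getVert_zero, h1]
    · have h1 := List.formPerm_apply_getElem _ hnd i (by omega)
      rw [hget, hget, ← hc, hl, Nat.mod_eq_of_lt hi] at h1
      exact h1
  have hsupp : c.support = p.support.tail.toFinset :=
    List.support_formPerm_of_nodup _ hnd fun y hy => by
      rw [hy] at hl
      simp at hl
      omega
  have hmove : ∀ y, c y ≠ y → ∃ i < p.length, p.getVert i = y := by
    intro y hy
    rw [← Equiv.Perm.mem_support, hsupp, List.mem_toFinset, List.mem_iff_getElem] at hy
    obtain ⟨i, hi, rfl⟩ := hy
    rw [hget]
    rcases (Nat.succ_le_of_lt (hl ▸ hi : i < p.length)).lt_or_eq with h | h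
    · exact ⟨i + 1, h, rfl⟩
    · refine ⟨0, by omega, ?_⟩
      rw [p.getVert_zero, show i + 1 = p.length from h, p.getVert_length]
  refine ⟨c, ⟨List.isCycle_formPerm hnd (by omega), ?_, ?_⟩,
    permSubgraph_eq_toSubgraph p c hstep hmove (by omega)⟩
  · rw [hsupp, List.toFinset_card_of_nodup hnd, hl]
    exact hlen
  · intro y hy
    obtain ⟨i, hi, rfl⟩ := hmove y hy
    rw [hstep i hi]
    exact p.adj_getVert_succ hi

theorem vertexFinset_permSubgraph (c : Equiv.Perm V) :
    vertexFinset (permSubgraph G c) = c.support := by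
  classical
  ext x
  rw [vertexFinset, Finset.mem_filter_univ, Equiv.Perm.mem_support]
  rfl

open Classical in
-- The factor `2` counts orientations: over each cycle subgraph lie exactly `c` and `c⁻¹`, distinct
-- because the length is at least three.
theorem sum_isGraphCycle_eq {B : Type*} [CommRing B] (P : G.Subgraph → Prop)
    (g : Finset V → B) :
    ∑ c : Equiv.Perm V with IsGraphCycle G c ∧ P (permSubgraph G c), g c.support
      = 2 * ∑ Z : G.Subgraph with IsCycleSubgraph Z ∧ P Z, g (vertexFinset Z) := by
  rw [← Finset.sum_fiberwise_of_maps_to (g := permSubgraph G)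
    (t := {Z : G.Subgraph | IsCycleSubgraph Z ∧ P Z}), Finset.mul_sum]
  · refine Finset.sum_congr rfl fun Z hZ => ?_
    rw [Finset.mem_filter_univ] at hZ
    obtain ⟨c, hc, rfl⟩ := exists_isGraphCycle_of_isCycleSubgraph hZ.1
    have hfib : ({c' : Equiv.Perm V | IsGraphCycle G c' ∧ P (permSubgraph G c')} :
        Finset _).filter (fun c' => permSubgraph G c' = permSubgraph G c) = {c, c⁻¹} := by
      ext c'
      rw [Finset.mem_filter, Finset.mem_filter_univ, Finset.mem_insert, Finset.mem_singleton]
      constructor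
      · rintro ⟨⟨h', -⟩, heq⟩
        exact hc.eq_or_eq_inv h' heq
      · rintro (rfl | rfl)
        · exact ⟨⟨hc, hZ.2⟩, rfl⟩
        · rw [permSubgraph_inv]
          exact ⟨⟨hc.inv, hZ.2⟩, rfl⟩
    rw [hfib, Finset.sum_pair hc.inv_ne.symm, Equiv.Perm.support_inv, vertexFinset_permSubgraph,
      two_mul]
  · intro c hc
    rw [Finset.mem_filter_univ] at hc ⊢
    exact ⟨hc.1.isCycleSubgraph, hc.2⟩

end

/-! ### Recursions for the generating polynomial -/

section

variable {A : Type*} [CommRing A]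

theorem immanantPoly_submatrix_equiv {α β : Type*} [Fintype α] [DecidableEq α] [Fintype β]
    [DecidableEq β] (e : β ≃ α) (M : Matrix α α A) :
    immanantPoly (M.submatrix e e) = immanantPoly M := by
  refine Fintype.sum_equiv e.permCongr _ _ fun σ => ?_
  congr 2
  · refine Fintype.prod_equiv e _ _ fun x => ?_
    simp
  · rw [← Matrix.charpoly_reindex e]
    congr 1
    ext x y
    simp [actionMatrix, Equiv.eq_symm_apply]
    congr

variable {V : Type*} [Fintype V] [DecidableEq V]

theorem immanantPolyCompl_congr {M M' : Matrix V V A} {S : Finset V}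
    (h : ∀ x y, x ∉ S → y ∉ S → M x y = M' x y) :
    immanantPolyCompl M S = immanantPolyCompl M' S := by
  rw [immanantPolyCompl, immanantPolyCompl]
  congr 1
  ext x y
  exact h x y x.2 y.2

theorem immanantPolyCompl_submatrix_singleton (M : Matrix V V A) {S : Finset V} {v : V}
    (hv : v ∉ S) :
    immanantPolyCompl (M.submatrix (Subtype.val : {x // x ∉ S} → V) Subtype.val) {⟨v, hv⟩}
      = immanantPolyCompl M (insert v S) := by
  let e : {x : {x // x ∉ S} // x ∉ ({⟨v, hv⟩} : Finset {x // x ∉ S})} ≃ {x // x ∉ insert v S} :=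
    { toFun := fun x => ⟨x.1.1, fun h => by
        rcases Finset.mem_insert.1 h with h | h
        · exact x.2 (Finset.mem_singleton.2 (Subtype.ext h))
        · exact x.1.2 h⟩
      invFun := fun x => ⟨⟨x.1, fun h => x.2 (Finset.mem_insert_of_mem h)⟩, fun h =>
        x.2 (Finset.mem_insert.2 (Or.inl (congrArg Subtype.val (Finset.mem_singleton.1 h))))⟩
      left_inv := fun _ => rfl
      right_inv := fun _ => rfl }
  rw [immanantPolyCompl, immanantPolyCompl, ← immanantPoly_submatrix_equiv e]
  rfl

/-- The contribution of the cycle `c` through `v` to the generating polynomial of `M`. -/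
def cycleTerm (M : Matrix V V A) (v : V) (c : Equiv.Perm V) : A[X] :=
  C (∏ x ∈ cycleSupport v c, M x (c x)) *
    ((X ^ (cycleSupport v c).card - (-1) ^ (cycleSupport v c).card)
      * immanantPolyCompl M (cycleSupport v c))

theorem cycleSupport_of_apply_ne {v : V} {c : Equiv.Perm V} (h : c v ≠ v) :
    cycleSupport v c = c.support := Finset.insert_eq_self.2 (Equiv.Perm.mem_support.2 h)

theorem cycleTerm_one (M : Matrix V V A) (v : V) :
    cycleTerm M v 1 = C (M v v) * ((X + 1) * immanantPolyCompl M {v}) := by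
  have h : cycleSupport v (1 : Equiv.Perm V) = {v} := by simp [cycleSupport]
  rw [cycleTerm, h]
  simp

theorem apply_ne_of_cycleOf_eq {v : V} {c : Equiv.Perm V} (hc : c.cycleOf v = c) (h : c ≠ 1) :
    c.IsCycle ∧ c v ≠ v := by
  have hv : c v ≠ v := fun hv => h (by rw [← hc, Equiv.Perm.cycleOf_eq_one_iff, hv])
  exact ⟨hc ▸ Equiv.Perm.isCycle_cycleOf c hv, hv⟩

/-- The entry at `(v, v)` occurs only in the term where `v` is a fixed point, so the polynomial is
affine in it. -/
theorem immanantPoly_update_diagonal {M M' : Matrix V V A} (v : V)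
    (h : ∀ x y, ¬ (x = v ∧ y = v) → M x y = M' x y) :
    immanantPoly M = immanantPoly M'
      + C (M v v - M' v v) * ((X + 1) * immanantPolyCompl M {v}) := by
  have hterm : ∀ c : Equiv.Perm V, c.cycleOf v = c → c ≠ 1 →
      cycleTerm M v c = cycleTerm M' v c := by
    intro c hc hc1
    have hcv := (apply_ne_of_cycleOf_eq hc hc1).2
    rw [cycleTerm, cycleTerm, immanantPolyCompl_congr (M := M) (M' := M')]
    · congr 2
      refine Finset.prod_congr rfl fun x _ => h _ _ ?_
      rintro ⟨rfl, h2⟩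
      exact hcv h2
    · intro x y hx _
      refine h x y fun hxy => hx ?_
      rw [hxy.1]
      exact Finset.mem_insert_self _ _
  have h1 : (1 : Equiv.Perm V) ∈ ({c : Equiv.Perm V | c.cycleOf v = c} : Finset _) := by
    rw [Finset.mem_filter_univ, Equiv.Perm.cycleOf_one]
  have hM := immanantPoly_eq_sum_cycles M v
  have hM' := immanantPoly_eq_sum_cycles M' v
  rw [← Finset.add_sum_erase _ _ h1] at hM hM'
  have hrest := Finset.sum_congr (f := cycleTerm M v) (g := cycleTerm M' v)
    (s₁ := Finset.erase {c : Equiv.Perm V | c.cycleOf v = c} 1) rfl fun c hc => by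
      rw [Finset.mem_erase, Finset.mem_filter_univ] at hc
      exact hterm c hc.2 hc.1
  have hone := cycleTerm_one M v
  have hone' := cycleTerm_one M' v
  have hcompl : immanantPolyCompl M {v} = immanantPolyCompl M' {v} :=
    immanantPolyCompl_congr fun x y hx _ => h x y fun hxy => hx (Finset.mem_singleton.2 hxy.1)
  rw [← hcompl] at hone'
  change _ = cycleTerm M v 1 + ∑ c ∈ _, cycleTerm M v c at hM
  change _ = cycleTerm M' v 1 + ∑ c ∈ _, cycleTerm M' v c at hM'
  rw [hM, hM', hrest, hone, hone', C_sub]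
  ring

theorem immanantPolyCompl_update_diagonal {M M' : Matrix V V A} {S : Finset V} {v : V}
    (hv : v ∉ S) (h : ∀ x y, ¬ (x = v ∧ y = v) → M x y = M' x y) :
    immanantPolyCompl M S = immanantPolyCompl M' S
      + C (M v v - M' v v) * ((X + 1) * immanantPolyCompl M (insert v S)) := by
  rw [← immanantPolyCompl_submatrix_singleton M hv]
  refine immanantPoly_update_diagonal (⟨v, hv⟩ : {x // x ∉ S}) fun x y hxy => h x y fun h' => ?_
  exact hxy ⟨Subtype.ext h'.1, Subtype.ext h'.2⟩

/-- A sum over the cycles through `v` that is supported on cycles moving along edges of `G` splits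
into the identity, the transpositions and the longer cycles. -/
theorem sum_cycles_eq {B : Type*} [AddCommMonoid B] (G : SimpleGraph V)
    [DecidableRel G.Adj] (v : V) (f : Equiv.Perm V → B)
    (hf : ∀ c : Equiv.Perm V, c v ≠ v → (∃ x, c x ≠ x ∧ ¬ G.Adj x (c x)) → f c = 0)
    [DecidablePred fun c : Equiv.Perm V => IsGraphCycle G c ∧ v ∈ (permSubgraph G c).verts] :
    ∑ c : Equiv.Perm V with c.cycleOf v = c, f c =
      f 1 + (∑ u ∈ G.neighborFinset v, f (Equiv.swap v u)
        + ∑ c : Equiv.Perm V with IsGraphCycle G c ∧ v ∈ (permSubgraph G c).verts, f c) := by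
  have hcyc : ∀ c : Equiv.Perm V, c.IsCycle → c v ≠ v → c.cycleOf v = c := fun c h hv =>
    h.cycleOf_eq hv
  have hswap : ∀ u, G.Adj v u → (Equiv.swap v u).cycleOf v = Equiv.swap v u := fun u hu =>
    hcyc _ (Equiv.Perm.isCycle_swap hu.ne) (by rw [Equiv.swap_apply_left]; exact hu.ne')
  have hinj : Set.InjOn (fun u => Equiv.swap v u) (G.neighborFinset v) := by
    intro u _ u' _ h
    have := congrArg (fun c : Equiv.Perm V => c v) h
    simpa using this
  have hdisj : Disjoint ((G.neighborFinset v).image (fun u => Equiv.swap v u))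
      ({c : Equiv.Perm V | IsGraphCycle G c ∧ v ∈ (permSubgraph G c).verts} : Finset _) := by
    rw [Finset.disjoint_left]
    rintro _ hc hc'
    obtain ⟨u, hu, rfl⟩ := Finset.mem_image.1 hc
    rw [SimpleGraph.mem_neighborFinset] at hu
    have := ((Finset.mem_filter_univ _).1 hc').1.three_le
    rw [Equiv.Perm.card_support_swap hu.ne] at this
    omega
  have h1 : (1 : Equiv.Perm V) ∉ (G.neighborFinset v).image (fun u => Equiv.swap v u) ∪
      ({c : Equiv.Perm V | IsGraphCycle G c ∧ v ∈ (permSubgraph G c).verts} : Finset _) := by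
    rw [Finset.mem_union, not_or]
    constructor
    · intro h
      obtain ⟨u, hu, h⟩ := Finset.mem_image.1 h
      rw [SimpleGraph.mem_neighborFinset] at hu
      exact (Equiv.Perm.isCycle_swap hu.ne).ne_one h
    · intro h
      exact ((Finset.mem_filter_univ _).1 h).1.isCycle.ne_one rfl
  rw [← Finset.sum_image (f := f) hinj, ← Finset.sum_union hdisj, ← Finset.sum_insert h1]
  symm
  refine Finset.sum_subset ?_ ?_
  · intro c hc
    rw [Finset.mem_filter_univ]
    rw [Finset.mem_insert, Finset.mem_union, Finset.mem_image, Finset.mem_filter_univ] at hc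
    rcases hc with rfl | ⟨u, hu, rfl⟩ | ⟨h, hv⟩
    · exact Equiv.Perm.cycleOf_one v
    · rw [SimpleGraph.mem_neighborFinset] at hu
      exact hswap u hu
    · exact hcyc c h.isCycle hv
  · intro c hc hc'
    rw [Finset.mem_filter_univ] at hc
    rw [Finset.mem_insert, Finset.mem_union, Finset.mem_image, Finset.mem_filter_univ, not_or,
      not_or] at hc'
    obtain ⟨hne, hnswap, hncyc⟩ := hc'
    obtain ⟨hc1, hcv⟩ := apply_ne_of_cycleOf_eq hc hne
    refine hf c hcv ?_
    by_contra hadj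
    push Not at hadj
    -- A cycle along edges is a transposition with a neighbour or has length at least three, and
    -- both were excluded.
    rcases (Equiv.Perm.two_le_card_support_of_ne_one hne).eq_or_lt with h2 | h3
    · obtain ⟨x, y, hxy, rfl⟩ := Equiv.Perm.card_support_eq_two.1 h2.symm
      refine hnswap ?_
      have hmem : v ∈ (Equiv.swap x y).support := Equiv.Perm.mem_support.2 hcv
      have hvadj := hadj v hcv
      rw [Equiv.Perm.support_swap hxy, Finset.mem_insert, Finset.mem_singleton] at hmem
      rcases hmem with rfl | rfl
      · rw [Equiv.swap_apply_left] at hvadj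
        exact ⟨y, (G.mem_neighborFinset _ _).2 hvadj, rfl⟩
      · rw [Equiv.swap_apply_right] at hvadj
        exact ⟨x, (G.mem_neighborFinset _ _).2 hvadj, Equiv.swap_comm _ _⟩
    · exact hncyc ⟨⟨hc1, h3, hadj⟩, hcv⟩

/-! ### Vertex and edge recursions for matrices supported on a graph -/

section

variable (G : SimpleGraph V) [DecidableRel G.Adj] {M : Matrix V V A} {w : A}

theorem cycleTerm_eq_zero (hM : ∀ x y, x ≠ y → M x y = if G.Adj x y then w else 0) (v : V)
    {c : Equiv.Perm V} (hc : ∃ x, c x ≠ x ∧ ¬ G.Adj x (c x)) : cycleTerm M v c = 0 := by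
  obtain ⟨x, hx, hadj⟩ := hc
  have hmem : x ∈ cycleSupport v c := Finset.mem_insert_of_mem (Equiv.Perm.mem_support.2 hx)
  rw [cycleTerm, Finset.prod_eq_zero hmem (by rw [hM _ _ hx.symm, if_neg hadj]), C_0, zero_mul]

theorem cycleTerm_of_adj (hM : ∀ x y, x ≠ y → M x y = if G.Adj x y then w else 0) {v : V}
    {c : Equiv.Perm V} (hv : c v ≠ v) (hc : ∀ x, c x ≠ x → G.Adj x (c x)) :
    cycleTerm M v c = C (w ^ c.support.card) *
      ((X ^ c.support.card - (-1) ^ c.support.card) * immanantPolyCompl M c.support) := by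
  rw [cycleTerm, cycleSupport_of_apply_ne hv, Finset.prod_congr rfl (g := fun _ => w)]
  · rw [Finset.prod_const]
  · intro x hx
    rw [Equiv.Perm.mem_support] at hx
    rw [hM _ _ hx.symm, if_pos (hc x hx)]

theorem cycleTerm_swap (hM : ∀ x y, x ≠ y → M x y = if G.Adj x y then w else 0) {u v : V}
    (h : G.Adj v u) : cycleTerm M v (Equiv.swap v u) =
      C (w ^ 2) * ((X ^ 2 - 1) * immanantPolyCompl M {u, v}) := by
  rw [cycleTerm_of_adj G hM, Equiv.Perm.support_swap h.ne, Finset.card_pair h.ne, Finset.pair_comm]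
  · norm_num
  · rw [Equiv.swap_apply_left]
    exact h.ne'
  · intro x hx
    have hmem : x ∈ (Equiv.swap v u).support := Equiv.Perm.mem_support.2 hx
    rw [Equiv.Perm.support_swap h.ne, Finset.mem_insert, Finset.mem_singleton] at hmem
    rcases hmem with rfl | rfl
    · rw [Equiv.swap_apply_left]
      exact h
    · rw [Equiv.swap_apply_right]
      exact h.symm

/-- The contribution of the cycles with vertex set `S` in one direction. -/
def vertexSetTerm (M : Matrix V V A) (w : A) (S : Finset V) : A[X] :=
  C (w ^ S.card) * ((X ^ S.card - (-1) ^ S.card) * immanantPolyCompl M S)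

theorem immanantPoly_eq_vertex (hM : ∀ x y, x ≠ y → M x y = if G.Adj x y then w else 0) (v : V) :
    immanantPoly M = C (M v v) * ((X + 1) * immanantPolyCompl M {v})
      + (∑ u ∈ G.neighborFinset v, C (w ^ 2) * ((X ^ 2 - 1) * immanantPolyCompl M {u, v})
        + 2 * ∑ Z ∈ cyclesThroughVertex G v, vertexSetTerm M w (vertexFinset Z)) := by
  classical
  have hsum : 2 * ∑ Z ∈ cyclesThroughVertex G v, vertexSetTerm M w (vertexFinset Z) =
      ∑ c : Equiv.Perm V with IsGraphCycle G c ∧ v ∈ (permSubgraph G c).verts,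
        vertexSetTerm M w c.support := by
    unfold cyclesThroughVertex
    convert (sum_isGraphCycle_eq (fun Z : G.Subgraph => v ∈ Z.verts) (vertexSetTerm M w)).symm
  rw [hsum, ← cycleTerm_one]
  have h := immanantPoly_eq_sum_cycles M v
  change _ = ∑ c ∈ _, cycleTerm M v c at h
  rw [h, sum_cycles_eq G v (cycleTerm M v) fun c _ hc => cycleTerm_eq_zero G hM v hc]
  have hswap : ∀ u ∈ G.neighborFinset v, cycleTerm M v (Equiv.swap v u) =
      C (w ^ 2) * ((X ^ 2 - 1) * immanantPolyCompl M {u, v}) := fun u hu =>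
    cycleTerm_swap G hM ((G.mem_neighborFinset _ _).1 hu)
  have hcyc : ∀ c ∈ ({c : Equiv.Perm V | IsGraphCycle G c ∧ v ∈ (permSubgraph G c).verts} :
      Finset _), cycleTerm M v c = vertexSetTerm M w c.support := fun c hc =>
    have hc' := (Finset.mem_filter_univ _).1 hc
    cycleTerm_of_adj G hM hc'.2 hc'.1.adj
  rw [Finset.sum_congr rfl hswap, Finset.sum_congr rfl hcyc]

/-- Both polynomials are expanded at `v`. Cycles avoiding the edge contribute equally, since
deleting `v` already removes the changed entries from the remaining submatrix. Cycles using it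
contribute zero for `M'`, so the difference is the transposition of `u` and `v` plus the longer
cycles through the edge. -/
theorem immanantPoly_delete_edge {M' : Matrix V V A} {u v : V} (huv : G.Adj u v)
    (hM : ∀ x y, x ≠ y → M x y = if G.Adj x y then w else 0)
    (hM' : ∀ x y, s(x, y) ≠ s(u, v) → M x y = M' x y) (huv' : M' u v = 0) (hvu' : M' v u = 0) :
    immanantPoly M = immanantPoly M'
      + (C (w ^ 2) * ((X ^ 2 - 1) * immanantPolyCompl M {u, v})
        + 2 * ∑ Z ∈ cyclesThroughEdge G s(u, v), vertexSetTerm M w (vertexFinset Z)) := by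
  classical
  have hsum : 2 * ∑ Z ∈ cyclesThroughEdge G s(u, v), vertexSetTerm M w (vertexFinset Z) =
      ∑ c : Equiv.Perm V with IsGraphCycle G c ∧ s(u, v) ∈ (permSubgraph G c).edgeSet,
        vertexSetTerm M w c.support := by
    unfold cyclesThroughEdge
    convert (sum_isGraphCycle_eq (fun Z : G.Subgraph => s(u, v) ∈ Z.edgeSet)
      (vertexSetTerm M w)).symm
  rw [hsum]
  have hsame : ∀ c : Equiv.Perm V, c u ≠ v → c v ≠ u → cycleTerm M v c = cycleTerm M' v c := by
    intro c h1 h2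
    rw [cycleTerm, cycleTerm, immanantPolyCompl_congr (M := M) (M' := M')]
    · congr 2
      refine Finset.prod_congr rfl fun x _ => hM' _ _ fun h => ?_
      rw [Sym2.eq_iff] at h
      rcases h with ⟨rfl, h⟩ | ⟨rfl, h⟩
      · exact h1 h
      · exact h2 h
    · intro x y hx hy
      refine hM' x y fun h => ?_
      have hv : v ∈ cycleSupport v c := Finset.mem_insert_self _ _
      rw [Sym2.eq_iff] at h
      rcases h with ⟨-, rfl⟩ | ⟨rfl, -⟩
      · exact hy hv
      · exact hx hv
  have hzero : ∀ c : Equiv.Perm V, c u = v ∨ c v = u → cycleTerm M' v c = 0 := by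
    intro c hc
    rw [cycleTerm]
    rcases hc with hc | hc
    · have hmem : u ∈ cycleSupport v c := Finset.mem_insert_of_mem <| Equiv.Perm.mem_support.2 <| by
        rw [hc]
        exact huv.ne'
      rw [Finset.prod_eq_zero hmem (by rw [hc, huv']), C_0, zero_mul]
    · have hmem : v ∈ cycleSupport v c := Finset.mem_insert_self _ _
      rw [Finset.prod_eq_zero hmem (by rw [hc, hvu']), C_0, zero_mul]
  have h := immanantPoly_eq_sum_cycles M v
  have h' := immanantPoly_eq_sum_cycles M' v
  change _ = ∑ c ∈ _, cycleTerm M v c at h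
  change _ = ∑ c ∈ _, cycleTerm M' v c at h'
  rw [← sub_eq_iff_eq_add', h, h', ← Finset.sum_sub_distrib,
    sum_cycles_eq G v fun c => cycleTerm M v c - cycleTerm M' v c]
  · rw [hsame 1 (by simpa using huv.ne) (by simpa using huv.ne'), sub_self, zero_add]
    congr 1
    · rw [Finset.sum_eq_single_of_mem u ((G.mem_neighborFinset _ _).2 huv.symm),
        hzero _ (Or.inl (Equiv.swap_apply_right v u)), sub_zero, cycleTerm_swap G hM huv.symm]
      intro x hx hxu
      rw [SimpleGraph.mem_neighborFinset] at hx
      refine sub_eq_zero.2 (hsame _ ?_ ?_)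
      · rw [Equiv.swap_apply_of_ne_of_ne huv.ne hxu.symm]
        exact huv.ne
      · rw [Equiv.swap_apply_left]
        exact hxu
    · have hedge : ∀ c, s(u, v) ∈ (permSubgraph G c).edgeSet ↔ c u = v ∨ c v = u := fun c =>
        ⟨fun h => h.2, fun h => ⟨huv, h⟩⟩
      have hmove : ∀ c : Equiv.Perm V, c u = v ∨ c v = u → c v ≠ v := by
        rintro c (hc | hc) hv
        · exact huv.ne (c.injective (hc.trans hv.symm))
        · exact huv.ne (hc.symm.trans hv)
      have hsub : ∑ c : Equiv.Perm V with IsGraphCycle G c ∧ v ∈ (permSubgraph G c).verts,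
          (cycleTerm M v c - cycleTerm M' v c)
          = ∑ c : Equiv.Perm V with IsGraphCycle G c ∧ s(u, v) ∈ (permSubgraph G c).edgeSet,
          (cycleTerm M v c - cycleTerm M' v c) := by
        refine (Finset.sum_subset ?_ ?_).symm
        · intro c hc
          rw [Finset.mem_filter_univ, hedge] at hc
          rw [Finset.mem_filter_univ]
          exact ⟨hc.1, hmove c hc.2⟩
        · intro c hc hc'
          rw [Finset.mem_filter_univ] at hc
          rw [Finset.mem_filter_univ, hedge] at hc'
          have hn : ¬ (c u = v ∨ c v = u) := fun h => hc' ⟨hc.1, h⟩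
          push Not at hn
          rw [hsame c hn.1 hn.2, sub_self]
      rw [hsub]
      refine Finset.sum_congr rfl fun c hc => ?_
      rw [Finset.mem_filter_univ, hedge] at hc
      rw [hzero c hc.2, sub_zero, cycleTerm_of_adj G hM (hmove c hc.2) hc.1.adj, vertexSetTerm]
  · intro c hcv hc
    rw [cycleTerm_eq_zero G hM v hc, zero_sub, neg_eq_zero]
    by_cases hcuv : c u = v ∨ c v = u
    · exact hzero c hcuv
    · push Not at hcuv
      rw [← hsame c hcuv.1 hcuv.2, cycleTerm_eq_zero G hM v hc]

end

end

/-! ### Hook immanantal polynomials of graph matrices -/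

theorem degree_eq_of_delete_edge {V : Type*} [Fintype V] {G G' : SimpleGraph V}
    [DecidableRel G.Adj] [DecidableRel G'.Adj]
    {u v : V} (h : ∀ x y, G'.Adj x y ↔ G.Adj x y ∧ s(x, y) ≠ s(u, v)) {x : V} (hu : x ≠ u)
    (hv : x ≠ v) : G.degree x = G'.degree x := by
  rw [← SimpleGraph.card_neighborFinset_eq_degree, ← SimpleGraph.card_neighborFinset_eq_degree]
  congr 1
  ext y
  rw [SimpleGraph.mem_neighborFinset, SimpleGraph.mem_neighborFinset, h, iff_self_and]
  intro _ hxy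
  rw [Sym2.eq_iff] at hxy
  rcases hxy with ⟨rfl, -⟩ | ⟨rfl, -⟩
  · exact hu rfl
  · exact hv rfl

theorem mem_vertexFinset {V : Type*} [Fintype V] {G : SimpleGraph V} {Z : G.Subgraph} {x : V} :
    x ∈ vertexFinset Z ↔ x ∈ Z.verts := by
  simp only [vertexFinset, Finset.mem_filter, Finset.mem_univ, true_and]

theorem mem_cyclesThroughEdge {V : Type*} [Fintype V] {G : SimpleGraph V} {Z : G.Subgraph}
    {e : Sym2 V} : Z ∈ cyclesThroughEdge G e ↔ IsCycleSubgraph Z ∧ e ∈ Z.edgeSet := by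
  simp only [cyclesThroughEdge, Finset.mem_filter, Finset.mem_univ, true_and]

section

variable {V : Type*} [Fintype V] [DecidableEq V]

theorem hookImmanantPoly_deleteRowsCols (k : ℤ) (M : Matrix V V ℝ) (S : Finset V) :
    hookImmanantPoly k (deleteRowsCols M S) = hookCoeff k (immanantPolyCompl M.charmatrix S) := by
  have h : (deleteRowsCols M S).charmatrix =
      M.charmatrix.submatrix (Subtype.val : {x // x ∉ S} → V) Subtype.val := by
    ext1 x y
    simp [deleteRowsCols, Matrix.charmatrix_apply, Matrix.diagonal_apply, Subtype.ext_iff]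
  rw [hookImmanantPoly, hookImmanant_eq_hookCoeff, immanantPolyCompl, h]

theorem hookCoeff_X_add_one_mul {A : Type*} [CommRing A] (k : ℤ) (f : A[X]) :
    hookCoeff k ((X + 1) * f) = hookCoeff (k - 1) f + hookCoeff k f := by
  rw [add_mul, one_mul, map_add, hookCoeff_X_mul]

theorem hookCoeff_X_sq_sub_one_mul {A : Type*} [CommRing A] (k : ℤ) (f : A[X]) :
    hookCoeff k ((X ^ 2 - 1) * f) = hookCoeff (k - 2) f - hookCoeff k f := by
  rw [sub_mul, one_mul, map_sub, hookCoeff_X_pow_mul]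
  rfl

theorem charmatrix_graphMatrix_self (β γ : ℝ) (G : SimpleGraph V) [DecidableRel G.Adj] (v : V) :
    (graphMatrix β γ G).charmatrix v v = X - C (β * (G.degree v : ℝ)) := by
  rw [Matrix.charmatrix_apply_eq]
  simp [graphMatrix, SimpleGraph.degMatrix]

theorem charmatrix_graphMatrix_of_ne (β γ : ℝ) (G : SimpleGraph V) [DecidableRel G.Adj] {x y : V}
    (h : x ≠ y) : (graphMatrix β γ G).charmatrix x y = if G.Adj x y then C (-γ) else 0 := by
  rw [Matrix.charmatrix_apply_ne _ _ _ h]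
  by_cases hxy : G.Adj x y <;> simp [graphMatrix, SimpleGraph.degMatrix, h, hxy]

/-- The sign of `(-γ) ^ l`, coming from the off-diagonal entries of `x I - H`, moves from the
constant term of `X ^ l - (-1) ^ l` to the shifted one. -/
theorem hookCoeff_vertexSetTerm (k : ℤ) (M : Matrix V V ℝ) (γ : ℝ) (S : Finset V) :
    hookCoeff k (vertexSetTerm M.charmatrix (C (-γ)) S) =
      C (γ ^ S.card) * ((-1) ^ S.card * hookImmanantPoly (k - (S.card : ℤ)) (deleteRowsCols M S)
        - hookImmanantPoly k (deleteRowsCols M S)) := by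
  have h : ((-1 : ℝ[X]) ^ S.card) * (-1) ^ S.card = 1 := by rw [← mul_pow]; simp
  have h2 : ((-1 : ℝ[X][X]) ^ S.card) = C ((-1) ^ S.card) := by simp
  rw [vertexSetTerm, hookCoeff_C_mul, sub_mul, map_sub, hookCoeff_X_pow_mul, h2, hookCoeff_C_mul,
    hookImmanantPoly_deleteRowsCols, hookImmanantPoly_deleteRowsCols, C_neg, neg_pow, C_pow]
  linear_combination (-(C γ ^ S.card) * hookCoeff k (immanantPolyCompl M.charmatrix S)) * h

theorem two_mul_sum_hookCoeff (k : ℤ) {ι : Type*} (s : Finset ι) (f : ι → ℝ[X][X]) :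
    hookCoeff k (2 * ∑ i ∈ s, f i) = 2 * ∑ i ∈ s, hookCoeff k (f i) := by
  rw [two_mul, two_mul, map_add, map_sum]

theorem hookImmanantPoly_eq_vertex (G : SimpleGraph V) [DecidableRel G.Adj] (β γ : ℝ) (k : ℤ)
    (v : V) :
    hookImmanantPoly k (graphMatrix β γ G) =
      (X - C (β * (G.degree v : ℝ))) *
          (hookImmanantPoly (k - 1) (deleteRowsCols (graphMatrix β γ G) {v})
            + hookImmanantPoly k (deleteRowsCols (graphMatrix β γ G) {v}))
        + C (γ ^ 2) * ∑ u ∈ G.neighborFinset v,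
            (hookImmanantPoly (k - 2) (deleteRowsCols (graphMatrix β γ G) {u, v})
              - hookImmanantPoly k (deleteRowsCols (graphMatrix β γ G) {u, v}))
        + 2 * ∑ Z ∈ cyclesThroughVertex G v,
            C (γ ^ (vertexFinset Z).card) *
              ((-1) ^ (vertexFinset Z).card *
                  hookImmanantPoly (k - ((vertexFinset Z).card : ℤ))
                    (deleteRowsCols (graphMatrix β γ G) (vertexFinset Z))
                - hookImmanantPoly k
                    (deleteRowsCols (graphMatrix β γ G) (vertexFinset Z))) := by
  rw [hookImmanantPoly, hookImmanant_eq_hookCoeff, immanantPoly_eq_vertex G (w := C (-γ))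
    (fun x y h => charmatrix_graphMatrix_of_ne β γ G h) v, map_add, map_add, hookCoeff_C_mul,
    hookCoeff_X_add_one_mul, map_sum, two_mul_sum_hookCoeff, charmatrix_graphMatrix_self, add_assoc]
  simp only [hookCoeff_vertexSetTerm, hookCoeff_C_mul, hookCoeff_X_sq_sub_one_mul,
    hookImmanantPoly_deleteRowsCols, Finset.mul_sum]
  simp

theorem degree_eq_add_one_of_delete_edge {G G' : SimpleGraph V} [DecidableRel G.Adj]
    [DecidableRel G'.Adj] {u v : V} (huv : G.Adj u v)
    (h : ∀ x y, G'.Adj x y ↔ G.Adj x y ∧ s(x, y) ≠ s(u, v)) : G.degree u = G'.degree u + 1 := by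
  have hins : G.neighborFinset u = insert v (G'.neighborFinset u) := by
    ext y
    rw [Finset.mem_insert, SimpleGraph.mem_neighborFinset, SimpleGraph.mem_neighborFinset, h]
    by_cases hy : y = v
    · simp [hy, huv]
    · simp [hy, huv.ne]
  rw [← SimpleGraph.card_neighborFinset_eq_degree, ← SimpleGraph.card_neighborFinset_eq_degree,
    hins, Finset.card_insert_of_notMem]
  rw [SimpleGraph.mem_neighborFinset, h]
  exact fun hn => hn.2 rfl

/-- Deleting the edge lowers two degrees, so `N` and `N'` differ by `-β` at `(u, u)` and at `(v,
v)`, besides the edge entries. Correcting `(u, u)` first leaves a minor without `u` whose entry at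
`v` is still old; correcting that one too produces the term in `β ^ 2`. -/
theorem immanantPoly_charmatrix_delete_edge {G G' : SimpleGraph V} [DecidableRel G.Adj]
    [DecidableRel G'.Adj] (β γ : ℝ) {u v : V} (huv : G.Adj u v)
    (h : ∀ x y, G'.Adj x y ↔ G.Adj x y ∧ s(x, y) ≠ s(u, v)) :
    immanantPoly (graphMatrix β γ G).charmatrix =
      immanantPoly (graphMatrix β γ G').charmatrix
        - C (C β) * ((X + 1) * immanantPolyCompl (graphMatrix β γ G').charmatrix {v})
        - C (C β) * ((X + 1) * immanantPolyCompl (graphMatrix β γ G').charmatrix {u})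
        + (C (C (β ^ 2)) *
              ((X + 1) * ((X + 1) * immanantPolyCompl (graphMatrix β γ G).charmatrix {u, v}))
            + C (C (γ ^ 2)) *
              ((X ^ 2 - 1) * immanantPolyCompl (graphMatrix β γ G).charmatrix {u, v}))
        + 2 * ∑ Z ∈ cyclesThroughEdge G s(u, v),
            vertexSetTerm (graphMatrix β γ G).charmatrix (C (-γ)) (vertexFinset Z) := by
  set N := (graphMatrix β γ G).charmatrix with hN
  set N' := (graphMatrix β γ G').charmatrix with hN'
  have hne : u ≠ v := huv.ne
  have hdiag : ∀ x, x ≠ u → x ≠ v → N x x = N' x x := by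
    intro x hxu hxv
    rw [hN, hN', charmatrix_graphMatrix_self, charmatrix_graphMatrix_self,
      degree_eq_of_delete_edge h hxu hxv]
  have hu : N u u - N' u u = -C β := by
    rw [hN, hN', charmatrix_graphMatrix_self, charmatrix_graphMatrix_self,
      degree_eq_add_one_of_delete_edge huv h]
    simp
    ring
  have hv : N v v - N' v v = -C β := by
    rw [hN, hN', charmatrix_graphMatrix_self, charmatrix_graphMatrix_self,
      degree_eq_add_one_of_delete_edge huv.symm fun x y => by rw [h, Sym2.eq_swap (a := u)]]
    simp
    ring
  have hoff : ∀ x y, x ≠ y → N x y = if G.Adj x y then C (-γ) else 0 := fun x y hxy =>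
    charmatrix_graphMatrix_of_ne β γ G hxy
  have hoff' : ∀ x y, x ≠ y → N' x y = if G'.Adj x y then C (-γ) else 0 := fun x y hxy =>
    charmatrix_graphMatrix_of_ne β γ G' hxy
  have hsame : ∀ x y, x ≠ y → s(x, y) ≠ s(u, v) → N x y = N' x y := by
    intro x y hxy hs
    rw [hoff x y hxy, hoff' x y hxy]
    simp only [h, hs, ne_eq, not_false_eq_true, and_true]
  -- The chain is `N`, `N1`, `N2`, `N'`; `N3` serves only to correct the entry at `v` in the minor
  -- of `N` without `u`.
  let N1 : Matrix V V ℝ[X] := Matrix.of fun x y => if x = u ∧ y = u then N' u u else N x y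
  let N2 : Matrix V V ℝ[X] := Matrix.of fun x y => if x = v ∧ y = v then N' v v else N1 x y
  let N3 : Matrix V V ℝ[X] := Matrix.of fun x y => if x = v ∧ y = v then N' v v else N x y
  have e1 := immanantPoly_update_diagonal (M := N) (M' := N1) u fun x y hxy => by
    simp only [N1, Matrix.of_apply, if_neg hxy]
  have e2 := immanantPoly_update_diagonal (M := N1) (M' := N2) v fun x y hxy => by
    simp only [N2, Matrix.of_apply, if_neg hxy]
  have hvu : v ∉ ({u} : Finset V) := by simpa using hne.symm
  have e3 := immanantPolyCompl_update_diagonal (M := N) (M' := N3) hvu fun x y hxy => by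
    simp only [N3, Matrix.of_apply, if_neg hxy]
  have hnotin : ∀ {x y}, (x ≠ u ∧ y ≠ u) ∨ (x ≠ v ∧ y ≠ v) → s(x, y) ≠ s(u, v) := by
    intro x y hxy hs
    rw [Sym2.eq_iff] at hs
    rcases hs with ⟨rfl, rfl⟩ | ⟨rfl, rfl⟩ <;> simp at hxy
  have c3 : immanantPolyCompl N3 {u} = immanantPolyCompl N' {u} := by
    refine immanantPolyCompl_congr fun x y hx hy => ?_
    rw [Finset.mem_singleton] at hx hy
    by_cases hxy : x = y
    · subst hxy
      by_cases hxv : x = v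
      · simp [N3, hxv]
      · simpa [N3, hxv] using hdiag x hx hxv
    · have : ¬ (x = v ∧ y = v) := fun hh => hxy (hh.1.trans hh.2.symm)
      simpa only [N3, Matrix.of_apply, if_neg this] using hsame x y hxy (hnotin (Or.inl ⟨hx, hy⟩))
  have c1 : immanantPolyCompl N1 {v} = immanantPolyCompl N' {v} := by
    refine immanantPolyCompl_congr fun x y hx hy => ?_
    rw [Finset.mem_singleton] at hx hy
    by_cases hxy : x = y
    · subst hxy
      by_cases hxu : x = u
      · simp [N1, hxu]
      · simpa [N1, hxu] using hdiag x hxu hx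
    · have : ¬ (x = u ∧ y = u) := fun hh => hxy (hh.1.trans hh.2.symm)
      simpa only [N1, Matrix.of_apply, if_neg this] using hsame x y hxy (hnotin (Or.inr ⟨hx, hy⟩))
  have hN2off : ∀ x y, x ≠ y → N2 x y = N x y := by
    intro x y hxy
    have h1 : ¬ (x = u ∧ y = u) := fun hh => hxy (hh.1.trans hh.2.symm)
    have h2 : ¬ (x = v ∧ y = v) := fun hh => hxy (hh.1.trans hh.2.symm)
    simp only [N2, N1, Matrix.of_apply, if_neg h1, if_neg h2]
  have c2 : ∀ S : Finset V, u ∈ S → v ∈ S → immanantPolyCompl N2 S = immanantPolyCompl N S := by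
    intro S huS hvS
    refine immanantPolyCompl_congr fun x y hx hy => ?_
    have h1 : ¬ (x = u ∧ y = u) := fun hh => hx (hh.1 ▸ huS)
    have h2 : ¬ (x = v ∧ y = v) := fun hh => hx (hh.1 ▸ hvS)
    simp only [N2, N1, Matrix.of_apply, if_neg h1, if_neg h2]
  have e4 := immanantPoly_delete_edge G (M := N2) (M' := N') (w := C (-γ)) huv
    (fun x y hxy => (hN2off x y hxy).trans (hoff x y hxy)) (fun x y hs => ?_) ?_ ?_
  · have hsum : ∑ Z ∈ cyclesThroughEdge G s(u, v), vertexSetTerm N2 (C (-γ)) (vertexFinset Z)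
        = ∑ Z ∈ cyclesThroughEdge G s(u, v), vertexSetTerm N (C (-γ)) (vertexFinset Z) := by
      refine Finset.sum_congr rfl fun Z hZ => ?_
      have hZuv : Z.Adj u v := (mem_cyclesThroughEdge.1 hZ).2
      rw [vertexSetTerm, vertexSetTerm, c2 _ (mem_vertexFinset.2 (Z.edge_vert hZuv))
        (mem_vertexFinset.2 (Z.edge_vert hZuv.symm))]
    have hN1v : N1 v v = N v v := by simp [N1, hne.symm]
    have hN1u : N1 u u = N' u u := by simp [N1]
    have hN2v : N2 v v = N' v v := by simp [N2]
    have hN3v : N3 v v = N' v v := by simp [N3]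
    rw [hN1u, hu, e2, c1, hN1v, hN2v, hv, e3, c3, hN3v, hv, Finset.pair_comm, e4, hsum,
      c2 {u, v} (by simp) (by simp)] at e1
    rw [e1]
    simp only [C_neg, neg_sq, C_pow]
    ring
  · by_cases hxy : x = y
    · subst hxy
      by_cases hxv : x = v
      · simp [N2, hxv]
      · by_cases hxu : x = u
        · simp [N2, N1, hxu, hne]
        · simpa [N2, N1, hxv, hxu] using hdiag x hxu hxv
    · rw [hN2off x y hxy]
      exact hsame x y hxy hs
  · rw [hoff' u v hne, if_neg]
    rw [h]
    exact fun hn => hn.2 rfl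
  · rw [hoff' v u hne.symm, if_neg]
    rw [h]
    exact fun hn => hn.2 Sym2.eq_swap

/-- The three coefficients at the minor without `u` and `v` are those of `β ^ 2 * (X + 1) ^ 2 + γ ^
2 * (X ^ 2 - 1)`. -/
theorem hookImmanantPoly_eq_edge {G G' : SimpleGraph V} [DecidableRel G.Adj] [DecidableRel G'.Adj]
    (β γ : ℝ) (k : ℤ) {u v : V} (huv : G.Adj u v)
    (h : ∀ x y, G'.Adj x y ↔ G.Adj x y ∧ s(x, y) ≠ s(u, v)) :
    hookImmanantPoly k (graphMatrix β γ G) =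
      hookImmanantPoly k (graphMatrix β γ G')
        - C β * (hookImmanantPoly k (deleteRowsCols (graphMatrix β γ G') {v})
            + hookImmanantPoly (k - 1) (deleteRowsCols (graphMatrix β γ G') {v}))
        - C β * (hookImmanantPoly k (deleteRowsCols (graphMatrix β γ G') {u})
            + hookImmanantPoly (k - 1) (deleteRowsCols (graphMatrix β γ G') {u}))
        + (C (β ^ 2 - γ ^ 2) * hookImmanantPoly k (deleteRowsCols (graphMatrix β γ G) {u, v})
            + C (2 * β ^ 2) * hookImmanantPoly (k - 1) (deleteRowsCols (graphMatrix β γ G) {u, v})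
            + C (β ^ 2 + γ ^ 2) *
              hookImmanantPoly (k - 2) (deleteRowsCols (graphMatrix β γ G) {u, v}))
        + 2 * ∑ Z ∈ cyclesThroughEdge G s(u, v),
            C (γ ^ (vertexFinset Z).card) *
              ((-1) ^ (vertexFinset Z).card *
                  hookImmanantPoly (k - ((vertexFinset Z).card : ℤ))
                    (deleteRowsCols (graphMatrix β γ G) (vertexFinset Z))
                - hookImmanantPoly k (deleteRowsCols (graphMatrix β γ G) (vertexFinset Z))) := by
  rw [hookImmanantPoly, hookImmanantPoly, hookImmanant_eq_hookCoeff, hookImmanant_eq_hookCoeff,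
    immanantPoly_charmatrix_delete_edge β γ huv h, map_add, two_mul_sum_hookCoeff]
  simp only [hookCoeff_vertexSetTerm]
  congr 1
  have hk : k - 1 - 1 = k - 2 := by ring
  simp only [map_add, map_sub, hookCoeff_C_mul, hookCoeff_X_sq_sub_one_mul,
    hookCoeff_X_add_one_mul, hookImmanantPoly_deleteRowsCols, hk]
  simp only [C_mul, C_pow, map_ofNat]
  ring

end

end

theorem theorem1p1 {V : Type*} [Fintype V] [DecidableEq V] (G : SimpleGraph V)
    [DecidableRel G.Adj] (β γ : ℝ) (k : ℤ) :
    (∀ v : V,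
      hookImmanantPoly k (graphMatrix β γ G) =
        (X - C (β * (G.degree v : ℝ))) *
            (hookImmanantPoly (k - 1) (deleteRowsCols (graphMatrix β γ G) {v})
              + hookImmanantPoly k (deleteRowsCols (graphMatrix β γ G) {v}))
          + C (γ ^ 2) * ∑ u ∈ G.neighborFinset v,
              (hookImmanantPoly (k - 2) (deleteRowsCols (graphMatrix β γ G) {u, v})
                - hookImmanantPoly k (deleteRowsCols (graphMatrix β γ G) {u, v}))
          + 2 * ∑ Z ∈ cyclesThroughVertex G v,
              C (γ ^ (vertexFinset Z).card) *
                ((-1) ^ (vertexFinset Z).card *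
                    hookImmanantPoly (k - ((vertexFinset Z).card : ℤ))
                      (deleteRowsCols (graphMatrix β γ G) (vertexFinset Z))
                  - hookImmanantPoly k
                      (deleteRowsCols (graphMatrix β γ G) (vertexFinset Z)))) ∧
    (∀ u v : V, G.Adj u v →
      hookImmanantPoly k (graphMatrix β γ G) =
        hookImmanantPoly k (graphMatrix β γ (G.deleteEdges {s(u, v)}))
          - C β *
            (hookImmanantPoly k
                (deleteRowsCols (graphMatrix β γ (G.deleteEdges {s(u, v)})) {v})
              + hookImmanantPoly (k - 1)
                (deleteRowsCols (graphMatrix β γ (G.deleteEdges {s(u, v)})) {v}))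
          - C β *
            (hookImmanantPoly k
                (deleteRowsCols (graphMatrix β γ (G.deleteEdges {s(u, v)})) {u})
              + hookImmanantPoly (k - 1)
                (deleteRowsCols (graphMatrix β γ (G.deleteEdges {s(u, v)})) {u}))
          + (C (β ^ 2 - γ ^ 2) *
                hookImmanantPoly k (deleteRowsCols (graphMatrix β γ G) {u, v})
              + C (2 * β ^ 2) *
                hookImmanantPoly (k - 1) (deleteRowsCols (graphMatrix β γ G) {u, v})
              + C (β ^ 2 + γ ^ 2) *
                hookImmanantPoly (k - 2) (deleteRowsCols (graphMatrix β γ G) {u, v}))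
          + 2 * ∑ Z ∈ cyclesThroughEdge G s(u, v),
              C (γ ^ (vertexFinset Z).card) *
                ((-1) ^ (vertexFinset Z).card *
                    hookImmanantPoly (k - ((vertexFinset Z).card : ℤ))
                      (deleteRowsCols (graphMatrix β γ G) (vertexFinset Z))
                  - hookImmanantPoly k
                      (deleteRowsCols (graphMatrix β γ G) (vertexFinset Z)))) := by
  refine ⟨fun v => hookImmanantPoly_eq_vertex G β γ k v, fun u v huv => ?_⟩
  refine hookImmanantPoly_eq_edge β γ k huv fun x y => ?_
  rw [SimpleGraph.deleteEdges_adj, Set.mem_singleton_iff]
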